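/- **Setting.** Let $m,n,N\ge 1$, let $f:\mathbb{R}^m\to\mathbb{R}$ be convex and $l_f$-Lipschitz, let $h:\mathbb{R}^n\to\mathbb{R}\cup\{+\infty\}$ be closed, convex and proper, and let $g=\frac1N\sum_{j=1}^N g_j$ with differentiable $g_j:\mathbb{R}^n\to\mathbb{R}^m$. Suppose that $g$ is Lipschitz and its Jacobian $g'$ is $L_g$-Lipschitz in the operator norm, and that there are $\widehat l_g,\widehat L_g$ such that every $g_j$ is $\widehat l_g$-Lipschitz and every $g_j'$ is $\widehat L_g$-Lipschitz in the operator norm. Put $\Phi=f\circ g+h$ and assume $\inf\Phi>-\infty$. Let $M>0$ with $M>5l_fL_g$. For $x\in\mathbb{R}^n$ the function $y\mapsto f(g(x)+g'(x)(y-x))+h(y)+\frac M2\|y-x\|_2^2$ has a unique minimizer $x_+$; the generalized gradient is $\mathcal{G}_M(x)=M(x-x_+)$. **Algorithm.** Given $x_0^0$ with $\Phi(x_0^0)<+\infty$, integers $K,\tau,a,b\ge1$ and tolerances $\overline\epsilon,\overline\delta>0$, for $k=0,\dots,K-1$ and $i=0,\dots,\tau-1$ compute estimates $\widetilde g_i^k,\widetilde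 J_i^k$ and set $x_{i+1}^k=\mathtt{solver}(s_i^k,\overline\epsilon,\overline\delta)$, where $s_i^k(x)=f(\widetilde g_i^k+\widetilde J_i^k(x-x_i^k))+h(x)+\frac M2\|x-x_i^k\|_2^2$; at the end of each epoch $x_0^{k+1}=x_\tau^k$. The estimates are $\widetilde g_0^k=g(x_0^k)$, $\widetilde J_0^k=g'(x_0^k)$ (computed from all $N$ components, whose values and Jacobians at $x_0^k$ are stored for the epoch), and for $i>0$ $$\widetilde g_i^k=\frac1a\sum_{j\in\mathcal{A}_i^k}\bigl(g_j(x_i^k)-g_j(x_0^k)-g_j'(x_0^k)(x_i^k-x_0^k)\bigr)+\widetilde g_0^k+\widetilde J_0^k(x_i^k-x_0^k),\qquad \widetilde J_i^k=\frac1b\sum_{j\in\mathcal{B}_i^k}\bigl(g_j'(x_i^k)-g_j'(x_0^k)\bigr)+\widetilde J_0^k,$$ where the batches $\mathcal{A}_i^k$ and $\mathcal{B}_i^k$, of sizes $a$ and $b$, are sampled uniformly with replacement from $\{1,\dots,N\}$; all batches and the internal randomness of all solver calls are independent. The solver (possibly randomized) satisfies: for all $\overline\epsilon,\overline\delta>0$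 and every subproblem $s$ of the above form, with probability at least $1-\overline\delta$ it returns $x_{\rm sol}$ with $s(x_{\rm sol})\le\inf s+\overline\epsilon$. **Claim.** For given $l_f,L_g,\widehat L_g,M$ and $D\ge0$ there are positive constants $C_\Sigma,C_a,C_b,c,C$, depending on nothing else, such that for every problem as above with $\Phi(x_0^0)-\inf\Phi\le D$ (in any dimensions $m,n$ and with any number $N$ of components), every such solver, every $\Delta\in(0,1)$, every integer $\tau>0$ and every $\epsilon>0$, the following holds with $$K=\Bigl\lceil\frac{C_\Sigma\epsilon^{-1}}{\tau}\Bigr\rceil,\quad a=\Bigl\lceil C_a\tau^4\log\frac{4(m+1)K\tau}{\Delta}\Bigr\rceil,\quad b=\Bigl\lceil C_b\tau^2\log\frac{4(m+n)K\tau}{\Delta}\Bigr\rceil,\quad\overline\delta=\frac{\Delta}{2K\tau},\quad\overline\epsilon=\frac{\epsilon}{5\cdot30M}.$$ (i) With probability at least $1-\Delta$, $\displaystyle\frac1{K\tau}\sum_{k=0}^{K-1}\sum_{i=0}^{\tau-1}\|\mathcal{G}_M(x_i^k)\|_2^2\le\epsilon$. (ii) On every run, the numbers of evaluations of components $g_j$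 and of component Jacobians $g_j'$ are respectively $$\widetilde\Theta\bigl(N+\tau^5+N\epsilon^{-1}\tau^{-1}+\epsilon^{-1}\tau^4\bigr)\quad\text{and}\quad\widetilde\Theta\bigl(N+\tau^3+N\epsilon^{-1}\tau^{-1}+\epsilon^{-1}\tau^2\bigr).$$ That is, writing $R$ for the respective expression in parentheses, the number is at least $cR$ and at most $CR\log\frac{4(m+1)(\tau+\epsilon^{-1})}{\Delta}$ for evaluations, respectively $CR\log\frac{4(m+n)(\tau+\epsilon^{-1})}{\Delta}$ for Jacobians; and when $\epsilon\le\min\{\frac12,\frac1\tau,\frac{\Delta}{m+n}\}$, both are at most $CR\log(1/\epsilon)$. -/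

import Mathlib

open MeasureTheory ProbabilityTheory
open scoped NNReal

namespace ProxLinear

/-- `ℝⁿ` with the Euclidean norm. -/
abbrev Vec (n : ℕ) : Type := EuclideanSpace ℝ (Fin n)

/-- Jacobians of maps `ℝⁿ → ℝᵐ`, as linear maps carrying the operator (spectral) norm. -/
abbrev Jac (n m : ℕ) : Type := Vec n →L[ℝ] Vec m

noncomputable section

/-! ### The composite problem -/

/-- The finite average `g(x) = (1/N) ∑ⱼ gⱼ(x)`. -/
def average {m n N : ℕ} (g : Fin N → Vec n → Vec m) (x : Vec n) : Vec m :=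
  (N : ℝ)⁻¹ • ∑ j, g j x

/-- The objective `Φ(x) = f(g(x)) + h(x)`, where `h` may take the value `+∞`. -/
def objective {m n N : ℕ} (f : Vec m → ℝ) (g : Fin N → Vec n → Vec m) (h : Vec n → EReal)
    (x : Vec n) : EReal :=
  (f (average g x) : EReal) + h x

/-- `h : ℝⁿ → ℝ ∪ {+∞}` is closed, convex and proper. -/
structure IsClosedConvexProper {n : ℕ} (h : Vec n → EReal) : Prop where
  ne_bot : ∀ x, h x ≠ ⊥
  exists_ne_top : ∃ x, h x ≠ ⊤
  closed : LowerSemicontinuous h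
  convex : Convex ℝ {p : Vec n × ℝ | h p.1 ≤ (p.2 : EReal)}

/-- The standing assumptions on `f`, on the average `g` of the components, and on `h`. -/
structure StandingAssumptions {m n N : ℕ} (f : Vec m → ℝ) (g : Fin N → Vec n → Vec m)
    (h : Vec n → EReal) (lf Lg : ℝ≥0) : Prop where
  f_convex : ConvexOn ℝ Set.univ f
  f_lipschitz : LipschitzWith lf f
  g_differentiable : ∀ j, Differentiable ℝ (g j)
  g_lipschitz : ∃ lg : ℝ≥0, LipschitzWith lg (average g)
  jac_lipschitz : LipschitzWith Lg (fun x => fderiv ℝ (average g) x)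
  h_closedConvexProper : IsClosedConvexProper h

/-- Uniform Lipschitz continuity of all components and of their Jacobians. -/
structure UniformLipschitz {m n N : ℕ} (g : Fin N → Vec n → Vec m) (Lhat : ℝ≥0) : Prop where
  lipschitz : ∃ lhat : ℝ≥0, ∀ j, LipschitzWith lhat (g j)
  jac_lipschitz : ∀ j, LipschitzWith Lhat (fun x => fderiv ℝ (g j) x)

/-- The proximal linearized model
`s(y) = f(u + J (y - x)) + h(y) + (M/2) ‖y - x‖²`. -/
def subproblem {m n : ℕ} (f : Vec m → ℝ) (h : Vec n → EReal) (M : ℝ)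
    (u : Vec m) (J : Jac n m) (x : Vec n) (y : Vec n) : EReal :=
  ((f (u + J (y - x)) + M / 2 * ‖y - x‖ ^ 2 : ℝ) : EReal) + h y

/-- `y` is an exact prox-linear step from `x`: it minimizes the model built with the true value
and the true Jacobian of `g` at `x`. -/
def IsProxLinearStep {m n N : ℕ} (f : Vec m → ℝ) (g : Fin N → Vec n → Vec m) (h : Vec n → EReal)
    (M : ℝ) (x y : Vec n) : Prop :=
  ∀ z, subproblem f h M (average g x) (fderiv ℝ (average g) x) x y ≤
    subproblem f h M (average g x) (fderiv ℝ (average g) x) x z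

/-- The exact prox-linear step `x₊`. -/
def proxLinearStep {m n N : ℕ} (f : Vec m → ℝ) (g : Fin N → Vec n → Vec m) (h : Vec n → EReal)
    (M : ℝ) (x : Vec n) : Vec n :=
  Classical.epsilon fun y => IsProxLinearStep f g h M x y

/-- The generalized gradient `𝒢_M(x) = M (x - x₊)`. -/
def genGrad {m n N : ℕ} (f : Vec m → ℝ) (g : Fin N → Vec n → Vec m) (h : Vec n → EReal)
    (M : ℝ) (x : Vec n) : Vec n :=
  M • (x - proxLinearStep f g h M x)

/-! ### Randomized solvers for the subproblems -/

/-- A (possibly randomized) solver: it receives an objective `s`, the tolerances `ε̄`, `δ̄`, and a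
random seed drawn from `law`, and returns a point. -/
structure Solver (n : ℕ) (S : Type*) [MeasurableSpace S] where
  law : Measure S
  run : (Vec n → EReal) → ℝ → ℝ → S → Vec n

/-- On every proximal linearized model `s` and for all tolerances `ε̄, δ̄ > 0`, the solver returns,
with probability at least `1 - δ̄`, a point with `s(x_sol) ≤ inf s + ε̄`. The output depends
measurably on the data of the model and on the seed. -/
structure SolverAssumption {m n : ℕ} {S : Type*} [MeasurableSpace S] (f : Vec m → ℝ)
    (h : Vec n → EReal) (M : ℝ) (solver : Solver n S) : Prop where
  isProbabilityMeasure : IsProbabilityMeasure solver.law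
  measurable : ∀ εbar δbar : ℝ, 0 < εbar → 0 < δbar →
    Measurable fun p : (Vec m × Jac n m × Vec n) × S =>
      solver.run (subproblem f h M p.1.1 p.1.2.1 p.1.2.2) εbar δbar p.2
  accurate : ∀ εbar δbar : ℝ, 0 < εbar → 0 < δbar →
    ∀ (u : Vec m) (J : Jac n m) (x : Vec n),
      ENNReal.ofReal (1 - δbar) ≤ solver.law
        {ξ | subproblem f h M u J x (solver.run (subproblem f h M u J x) εbar δbar ξ) ≤
          (⨅ y, subproblem f h M u J x y) + (εbar : EReal)}

/-! ### Computations that count oracle calls -/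

/-- The result of a computation, with the number of component evaluations `gⱼ(x)` and of component
Jacobians `gⱼ'(x)` requested from the oracle on the way. -/
structure Counted (α : Type*) where
  val : α
  evals : ℕ
  jacs : ℕ

namespace Counted

/-- A computation without oracle calls. -/
def pure {α : Type*} (v : α) : Counted α := ⟨v, 0, 0⟩

/-- Sequential composition. -/
def bind {α β : Type*} (p : Counted α) (q : α → Counted β) : Counted β :=
  ⟨(q p.val).val, p.evals + (q p.val).evals, p.jacs + (q p.val).jacs⟩

/-- Perform `s` computations and collect the results. -/
def batch {α : Type*} {s : ℕ} (q : Fin s → Counted α) : Counted (Fin s → α) :=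
  ⟨fun r => (q r).val, ∑ r, (q r).evals, ∑ r, (q r).jacs⟩

end Counted

/-- One call of the evaluation oracle. -/
def evalOracle {m n N : ℕ} (g : Fin N → Vec n → Vec m) (j : Fin N) (x : Vec n) :
    Counted (Vec m) := ⟨g j x, 1, 0⟩

/-- One call of the Jacobian oracle. -/
def jacOracle {m n N : ℕ} (g : Fin N → Vec n → Vec m) (j : Fin N) (x : Vec n) :
    Counted (Jac n m) := ⟨fderiv ℝ (g j) x, 0, 1⟩

/-! ### The estimator -/

/-- What is stored during an epoch: its first iterate `x₀ᵏ`, and all component values and component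
Jacobians there. -/
structure Memory (m n N : ℕ) where
  anchor : Vec n
  vals : Fin N → Vec m
  jacs : Fin N → Jac n m

/-- The estimates `g̃₀ᵏ`, `J̃₀ᵏ` at the start of the epoch: averages over all components. -/
def Memory.gtilde {m n N : ℕ} (mem : Memory m n N) : Vec m := (N : ℝ)⁻¹ • ∑ j, mem.vals j

/-- See `Memory.gtilde`. -/
def Memory.jtilde {m n N : ℕ} (mem : Memory m n N) : Jac n m := (N : ℝ)⁻¹ • ∑ j, mem.jacs j

/-- The first-order-corrected variance-reduced estimator for finite averages, called at the inner
iteration `i` and the current iterate `x`, with batches `A` and `B` of sizes `a` and `b`.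
It returns `((g̃, J̃), updated memory)`. For `i = 0` everything is evaluated at `x` and stored; for
`i > 0` only the terms involving `x` are requested, and those at the anchor are recalled. -/
def estimator {m n N a b : ℕ} (g : Fin N → Vec n → Vec m) (i : ℕ) (x : Vec n)
    (mem : Memory m n N) (A : Fin a → Fin N) (B : Fin b → Fin N) :
    Counted ((Vec m × Jac n m) × Memory m n N) :=
  if i = 0 then
    (Counted.batch fun j => evalOracle g j x).bind fun v =>
    (Counted.batch fun j => jacOracle g j x).bind fun J =>
    let mem' : Memory m n N := ⟨x, v, J⟩
    Counted.pure ((mem'.gtilde, mem'.jtilde), mem')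
  else
    (Counted.batch fun r => evalOracle g (A r) x).bind fun v =>
    (Counted.batch fun r => jacOracle g (B r) x).bind fun J =>
    Counted.pure
      (((a : ℝ)⁻¹ • ∑ r, (v r - mem.vals (A r) - mem.jacs (A r) (x - mem.anchor)) +
          mem.gtilde + mem.jtilde (x - mem.anchor),
        (b : ℝ)⁻¹ • ∑ r, (J r - mem.jacs (B r)) + mem.jtilde), mem)

/-! ### The inexact prox-linear method -/

/-- The random input of one inner iteration: the two batches and the seed of the solver. -/
abbrev Draw (N a b : ℕ) (S : Type*) : Type _ := (Fin a → Fin N) × (Fin b → Fin N) × S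

/-- The epoch starting at `start`: the iterate and the memory after `i` inner iterations. The
initial memory is empty; it is overwritten by the iteration `i = 0` and never read before. -/
def epoch {m n N a b : ℕ} {S : Type*} [MeasurableSpace S] (f : Vec m → ℝ)
    (g : Fin N → Vec n → Vec m) (h : Vec n → EReal) (M : ℝ) (solver : Solver n S)
    (εbar δbar : ℝ) (draw : ℕ → Draw N a b S) (start : Vec n) :
    ℕ → Counted (Vec n × Memory m n N)
  | 0 => Counted.pure (start, ⟨start, 0, 0⟩)
  | i + 1 =>
    (epoch f g h M solver εbar δbar draw start i).bind fun st =>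
    (estimator g i st.1 st.2 (draw i).1 (draw i).2.1).bind fun est =>
    Counted.pure
      (solver.run (subproblem f h M est.1.1 est.1.2 st.1) εbar δbar (draw i).2.2, est.2)

/-- The method after `k` epochs of lengths `τ 0, …, τ (k - 1)`, with the total numbers of oracle
calls made so far; the value is `x₀ᵏ`. -/
def method {m n N a b : ℕ} {S : Type*} [MeasurableSpace S] (f : Vec m → ℝ)
    (g : Fin N → Vec n → Vec m) (h : Vec n → EReal) (M : ℝ) (solver : Solver n S)
    (εbar δbar : ℝ) (τ : ℕ → ℕ) (draw : ℕ → ℕ → Draw N a b S) (x₀ : Vec n) :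
    ℕ → Counted (Vec n)
  | 0 => Counted.pure x₀
  | k + 1 =>
    (method f g h M solver εbar δbar τ draw x₀ k).bind fun x =>
    (epoch f g h M solver εbar δbar (draw k) x (τ k)).bind fun st => Counted.pure st.1

/-- The iterate `xᵢᵏ`. -/
def iterate {m n N a b : ℕ} {S : Type*} [MeasurableSpace S] (f : Vec m → ℝ)
    (g : Fin N → Vec n → Vec m) (h : Vec n → EReal) (M : ℝ) (solver : Solver n S)
    (εbar δbar : ℝ) (τ : ℕ → ℕ) (draw : ℕ → ℕ → Draw N a b S) (x₀ : Vec n) (k i : ℕ) : Vec n :=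
  (epoch f g h M solver εbar δbar (draw k)
    (method f g h M solver εbar δbar τ draw x₀ k).val i).val.1

/-- The law of a batch of size `s` sampled uniformly with replacement from the `N` components. -/
def batchLaw (N s : ℕ) : Measure (Fin s → Fin N) :=
  Measure.pi fun _ => uniformOn (Set.univ : Set (Fin N))

/-- The random inputs of the inner iterations `(k, i)`, `k < K`, `i < τ`, are independent, and each
consists of two independent uniform batches and an independent seed of the solver. -/
structure IsDraws {Ω S : Type*} [MeasurableSpace Ω] [MeasurableSpace S] {n N a b : ℕ}
    (P : Measure Ω) (solver : Solver n S) (K τ : ℕ) (draw : ℕ → ℕ → Ω → Draw N a b S) :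
    Prop where
  measurable : ∀ k < K, ∀ i < τ, Measurable (draw k i)
  indep : iIndepFun (fun p : Fin K × Fin τ => draw p.1 p.2) P
  law : ∀ k < K, ∀ i < τ,
    P.map (draw k i) = (batchLaw N a).prod ((batchLaw N b).prod solver.law)

/-! ### The rates -/

/-- `N + τ⁵ + N ε⁻¹ τ⁻¹ + ε⁻¹ τ⁴`. -/
def evalRate (N τ : ℕ) (ε : ℝ) : ℝ :=
  N + (τ : ℝ) ^ 5 + N * ε⁻¹ * (τ : ℝ)⁻¹ + ε⁻¹ * (τ : ℝ) ^ 4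

/-- `N + τ³ + N ε⁻¹ τ⁻¹ + ε⁻¹ τ²`. -/
def jacRate (N τ : ℕ) (ε : ℝ) : ℝ :=
  N + (τ : ℝ) ^ 3 + N * ε⁻¹ * (τ : ℝ)⁻¹ + ε⁻¹ * (τ : ℝ) ^ 2

end

end ProxLinear

open ProxLinear

/-! Let `P` be the length of the exact prox-linear step from the current point, `d` that of the step
actually taken, and `ρ` the distance from the current point to the epoch's anchor. Strong convexity
of the model shows that an accurate solver call lowers `Φ` by `(M/2) P² + (M/2 - lf Lg) d²`, up to
`εbar` and the errors of the two estimates (`objective_descent`). If these errors, multiplied by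
`lf`, are at most `(M/20)(ρ/τ)²` for the value and `(M/10)(ρ/τ)` for the Jacobian, Young's
inequality leaves a decrease of `(9/20) M P² + (M/4) d² - (M/5)(ρ/τ)² - εbar`
(`IsGoodDraw.descent`). Since `ρ` is bounded by a sum of at most `τ` step lengths, Cauchy–Schwarz
bounds the sum of `(ρ/τ)²` over an epoch by the sum of `d²`, and the `d²` terms absorb it
(`epoch_decrease`). Telescoping over the epochs bounds the sum of `P²`, hence of the squared
generalized gradients (`average_genGrad_le`).

The required precision comes from concentration. After the anchor terms cancel, the errors are batch
means of centered terms of size `O(ρ²)` for values and `O(ρ)` for Jacobians. Batches of order `τ⁴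
log` and `τ² log` therefore bring them down to the scales `(ρ/τ)²` and `ρ/τ`
(`batchLaw_valueEstimate_bad_le`, `batchLaw_jacEstimate_bad_le`). The current draw is independent of
the past, so the fixed-state bounds apply along the random trajectory (`prob_state_draw_le`), and a
union bound over the `Kτ` iterations finishes (i).

The matrix Hoeffding inequality is proved with trace moments instead of matrix exponentials. For a
centered random symmetric `X` with `‖X‖ ≤ L`, differentiating the mean of `tr (Y + tX)^(2q) / (2q)!`
twice in `t` gives at most `L²` times the same expression for `q - 1`, and the slope at `0`
vanishes. Integration bounds the moments by the coefficients of `cosh(Lt)`, which are dominated by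
those of `exp(L²t²/2)`. The latter convolve under independent summation
(`sum_batch_traceMoment_le`). Markov's inequality with `q` of the order of `log(d/δ)`, `d` being the
dimension, gives the tail bound, and self-adjoint dilation extends it to rectangular operators.

The costs in (ii) are deterministic: `K` epochs, each with one full pass and `τ - 1` batches. The
stated rates factor accordingly. -/

section TraceMoments

/-! ### Trace moments of sums of independent centered symmetric operators. -/

variable {E : Type*} [NormedAddCommGroup E] [InnerProductSpace ℝ E]

/-- Symmetry of an operator, as a property of its bilinear form. -/
def IsSymm (T : E →L[ℝ] E) : Prop := (T : E →ₗ[ℝ] E).IsSymmetric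

theorem IsSymm.add {S T : E →L[ℝ] E} (hS : IsSymm S) (hT : IsSymm T) : IsSymm (S + T) :=
  LinearMap.IsSymmetric.add hS hT

theorem IsSymm.smul {T : E →L[ℝ] E} (c : ℝ) (hT : IsSymm T) : IsSymm (c • T) := by
  intro x y
  have := hT x y
  simp only [ContinuousLinearMap.coe_coe] at this
  simp [inner_smul_left, inner_smul_right, this]

theorem isSymm_zero : IsSymm (0 : E →L[ℝ] E) := fun x y => by simp

theorem IsSymm.sum {ι : Type*} (s : Finset ι) {X : ι → E →L[ℝ] E} (hX : ∀ i, IsSymm (X i)) :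
    IsSymm (∑ i ∈ s, X i) := by
  classical
  induction s using Finset.induction_on with
  | empty => simpa using isSymm_zero
  | insert i s hi ih => rw [Finset.sum_insert hi]; exact (hX i).add ih

theorem hasDerivAt_line (Y B : E →L[ℝ] E) (t : ℝ) : HasDerivAt (fun t : ℝ => Y + t • B) B t := by
  simpa using ((hasDerivAt_id t).smul_const B).const_add Y

variable [FiniteDimensional ℝ E]

/-- The trace, as a continuous linear functional on the operators of a finite-dimensional space. -/
noncomputable def opTrace (E : Type*) [NormedAddCommGroup E] [InnerProductSpace ℝ E]
    [FiniteDimensional ℝ E] : (E →L[ℝ] E) →L[ℝ] ℝ :=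
  LinearMap.toContinuousLinearMap (LinearMap.trace ℝ E ∘ₗ ContinuousLinearMap.coeLM ℝ)

theorem opTrace_apply (T : E →L[ℝ] E) : opTrace E T = LinearMap.trace ℝ E (T : E →ₗ[ℝ] E) := rfl

theorem opTrace_mul_comm (S T : E →L[ℝ] E) : opTrace E (S * T) = opTrace E (T * S) := by
  simp only [opTrace_apply]
  exact LinearMap.trace_mul_comm ℝ (S : E →ₗ[ℝ] E) (T : E →ₗ[ℝ] E)

theorem opTrace_eq_sum_inner {ι : Type*} [Fintype ι] (e : OrthonormalBasis ι ℝ E) (T : E →L[ℝ] E) :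
    opTrace E T = ∑ i, inner ℝ (e i) (T (e i)) := by
  rw [opTrace_apply, LinearMap.trace_eq_sum_inner _ e]; rfl

theorem opTrace_one : opTrace E 1 = Module.finrank ℝ E := by
  rw [opTrace_apply]
  exact LinearMap.trace_one ℝ E

theorem IsSymm.exists_eigenbasis {Y : E →L[ℝ] E} (hY : IsSymm Y) :
    ∃ (e : OrthonormalBasis (Fin (Module.finrank ℝ E)) ℝ E) (lam : Fin (Module.finrank ℝ E) → ℝ),
      ∀ (p : ℕ) i, (Y ^ p) (e i) = lam i ^ p • e i := by
  refine ⟨hY.eigenvectorBasis rfl, hY.eigenvalues rfl, fun p i => ?_⟩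
  induction p with
  | zero => simp
  | succ p ih =>
    rw [pow_succ', mul_apply_eq_comp, ih, map_smul]
    have := hY.apply_eigenvectorBasis rfl i
    simp only [ContinuousLinearMap.coe_coe] at this
    rw [this, smul_smul, pow_succ]
    rfl

theorem opTrace_pow_eq {Y : E →L[ℝ] E} {ι : Type*} [Fintype ι] (e : OrthonormalBasis ι ℝ E)
    {lam : ι → ℝ} (he : ∀ (p : ℕ) i, (Y ^ p) (e i) = lam i ^ p • e i) (p : ℕ) :
    opTrace E (Y ^ p) = ∑ i, lam i ^ p := by
  rw [opTrace_eq_sum_inner e]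
  simp [he, inner_smul_right]

/-- For `j + k` even, `x ↦ xʲ` and `x ↦ xᵏ` satisfy the rearrangement inequality. -/
theorem pow_mul_pow_add_le {j k : ℕ} (h : Even (j + k)) (x y : ℝ) :
    x ^ j * y ^ k + x ^ k * y ^ j ≤ x ^ (j + k) + y ^ (j + k) := by
  suffices H : ∀ x y : ℝ, 0 ≤ x → 0 ≤ y →
      x ^ j * y ^ k + x ^ k * y ^ j ≤ x ^ (j + k) + y ^ (j + k) by
    have h1 := H |x| |y| (abs_nonneg _) (abs_nonneg _)
    rw [h.pow_abs, h.pow_abs, ← abs_pow, ← abs_pow, ← abs_pow, ← abs_pow, ← abs_mul, ← abs_mul] at h1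
    linarith [le_abs_self (x ^ j * y ^ k), le_abs_self (x ^ k * y ^ j)]
  intro x y hx hy
  rcases le_total x y with hxy | hxy
  · have := mul_nonneg (sub_nonneg.2 (pow_le_pow_left₀ hx hxy j))
      (sub_nonneg.2 (pow_le_pow_left₀ hx hxy k))
    rw [pow_add, pow_add]; nlinarith
  · have := mul_nonneg (sub_nonneg.2 (pow_le_pow_left₀ hy hxy j))
      (sub_nonneg.2 (pow_le_pow_left₀ hy hxy k))
    rw [pow_add, pow_add]; nlinarith

/-- In an eigenbasis of `Y` the trace is a double sum of `λₗʲ λᵢᵏ` with symmetric nonnegative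
weights, the squared entries of `B`. Symmetrizing in `(i, l)` and applying the rearrangement
inequality replaces mixed powers by pure ones. Each row of weights sums to `‖B eᵢ‖² ≤ L²`. This
makes the noncommuting second derivative behave like the scalar one. -/
theorem opTrace_sandwich_le {B Y : E →L[ℝ] E} (hB : IsSymm B) (hY : IsSymm Y) {L : ℝ}
    (hL : ‖B‖ ≤ L) {j k : ℕ} (hjk : Even (j + k)) :
    opTrace E (B * (Y ^ j * B * Y ^ k)) ≤ L ^ 2 * opTrace E (Y ^ (j + k)) := by
  obtain ⟨e, lam, he⟩ := hY.exists_eigenbasis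
  set β : Fin (Module.finrank ℝ E) → Fin (Module.finrank ℝ E) → ℝ :=
    fun i l => inner ℝ (e l) (B (e i)) with hβ
  have hBs : ∀ x y, inner ℝ (B x) y = inner ℝ x (B y) := fun x y => hB x y
  have hsymm : ∀ i l, β i l = β l i := fun i l => by
    simp only [hβ]; rw [← hBs, real_inner_comm]
  have hYp : ∀ (p : ℕ) (x : E) i, inner ℝ (e i) ((Y ^ p) x) = lam i ^ p * inner ℝ (e i) x := by
    intro p x i
    conv_lhs => rw [← e.sum_repr x]
    simp only [map_sum, map_smul, he, inner_sum, inner_smul_right]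
    rw [Finset.sum_eq_single i]
    · simp [e.repr_apply_apply]; ring
    · intro b _ hb
      simp [e.orthonormal.inner_eq_zero hb.symm]
    · simp
  have h1 : opTrace E (B * (Y ^ j * B * Y ^ k)) = ∑ i, ∑ l, lam l ^ j * lam i ^ k * β i l ^ 2 := by
    rw [opTrace_eq_sum_inner e]
    refine Finset.sum_congr rfl fun i _ => ?_
    simp only [mul_apply_eq_comp, he, map_smul, inner_smul_right]
    rw [← hBs, ← e.sum_inner_mul_inner, Finset.mul_sum]
    refine Finset.sum_congr rfl fun l _ => ?_
    rw [hYp]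
    simp only [hβ]
    rw [real_inner_comm (e l) (B (e i))]; ring
  have h2 : ∀ i, ∑ l, β i l ^ 2 ≤ L ^ 2 := fun i => by
    have : ∑ l, β i l ^ 2 = ‖B (e i)‖ ^ 2 := by
      rw [← e.sum_sq_norm_inner_right]
      simp [hβ]
    rw [this]
    have h3 : ‖B (e i)‖ ≤ L := by
      have := B.le_opNorm (e i)
      simp at this
      linarith
    exact pow_le_pow_left₀ (norm_nonneg _) h3 2
  have h3 : ∑ i, ∑ l, lam l ^ j * lam i ^ k * β i l ^ 2 =
      ∑ i, ∑ l, lam l ^ k * lam i ^ j * β i l ^ 2 := by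
    rw [Finset.sum_comm]
    refine Finset.sum_congr rfl fun i _ => Finset.sum_congr rfl fun l _ => ?_
    rw [hsymm l i]; ring
  have h4 : ∑ i, ∑ l, lam l ^ (j + k) * β i l ^ 2 = ∑ i, ∑ l, lam i ^ (j + k) * β i l ^ 2 := by
    rw [Finset.sum_comm]
    refine Finset.sum_congr rfl fun i _ => Finset.sum_congr rfl fun l _ => ?_
    rw [hsymm l i]
  have h5 : ∑ i, ∑ l, lam l ^ j * lam i ^ k * β i l ^ 2 +
      ∑ i, ∑ l, lam l ^ k * lam i ^ j * β i l ^ 2 ≤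
      ∑ i, ∑ l, lam l ^ (j + k) * β i l ^ 2 + ∑ i, ∑ l, lam i ^ (j + k) * β i l ^ 2 := by
    simp only [← Finset.sum_add_distrib]
    refine Finset.sum_le_sum fun i _ => Finset.sum_le_sum fun l _ => ?_
    have := mul_le_mul_of_nonneg_right (pow_mul_pow_add_le hjk (lam l) (lam i)) (sq_nonneg (β i l))
    linarith
  have h6 : ∑ i, ∑ l, lam i ^ (j + k) * β i l ^ 2 ≤ L ^ 2 * ∑ i, lam i ^ (j + k) := by
    rw [Finset.mul_sum]
    refine Finset.sum_le_sum fun i _ => ?_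
    rw [← Finset.mul_sum, mul_comm]
    exact mul_le_mul_of_nonneg_right (h2 i) (hjk.pow_nonneg _)
  rw [h1, opTrace_pow_eq e he]
  linarith

/-- If the even trace moment of a symmetric operator is at most `t ^ (2 q)`, its norm is at most
`t`. -/
theorem norm_le_of_opTrace_le {Y : E →L[ℝ] E} (hY : IsSymm Y) {t : ℝ} (ht : 0 ≤ t) {q : ℕ}
    (hq : q ≠ 0) (h : opTrace E (Y ^ (2 * q)) ≤ t ^ (2 * q)) : ‖Y‖ ≤ t := by
  obtain ⟨e, lam, he⟩ := hY.exists_eigenbasis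
  rw [opTrace_pow_eq e he] at h
  have hlam : ∀ i, lam i ^ 2 ≤ t ^ 2 := fun i => by
    have h1 : lam i ^ (2 * q) ≤ t ^ (2 * q) :=
      (Finset.single_le_sum (f := fun i => lam i ^ (2 * q))
        (fun i _ => (even_two_mul q).pow_nonneg _) (Finset.mem_univ i)).trans h
    rw [pow_mul, pow_mul] at h1
    exact le_of_pow_le_pow_left₀ hq (sq_nonneg t) h1
  refine Y.opNorm_le_bound ht fun x => ?_
  refine le_of_sq_le_sq ?_ (mul_nonneg ht (norm_nonneg x))
  have hYx : Y x = ∑ i, (inner ℝ (e i) x * lam i) • e i := by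
    conv_lhs => rw [← e.sum_repr x]
    rw [map_sum]
    refine Finset.sum_congr rfl fun i _ => ?_
    have := he 1 i
    rw [pow_one, pow_one] at this
    rw [map_smul, this, smul_smul, e.repr_apply_apply]
  have h1 : ‖Y x‖ ^ 2 = ∑ i, (inner ℝ (e i) x * lam i) ^ 2 := by
    rw [← e.sum_sq_norm_inner_right (Y x)]
    refine Finset.sum_congr rfl fun i _ => ?_
    rw [hYx, e.orthonormal.inner_right_fintype, Real.norm_eq_abs, sq_abs]
  rw [h1, mul_pow, ← e.sum_sq_norm_inner_right x, Finset.mul_sum]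
  refine Finset.sum_le_sum fun i _ => ?_
  rw [Real.norm_eq_abs, sq_abs, mul_pow, mul_comm]
  exact mul_le_mul_of_nonneg_right (hlam i) (sq_nonneg _)

/-- The normalized trace moment `tr Yᵖ / p!`. -/
noncomputable def traceMoment (p : ℕ) (Y : E →L[ℝ] E) : ℝ := opTrace E (Y ^ p) / p.factorial

theorem traceMoment_nonneg {Y : E →L[ℝ] E} (hY : IsSymm Y) (q : ℕ) :
    0 ≤ traceMoment (2 * q) Y := by
  obtain ⟨e, lam, he⟩ := hY.exists_eigenbasis
  rw [traceMoment, opTrace_pow_eq e he]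
  exact div_nonneg (Finset.sum_nonneg fun i _ => (even_two_mul q).pow_nonneg _) (by positivity)

/-- Cyclicity of the trace makes the `p + 1` terms of the noncommutative product rule equal, and
their number cancels against the factorial. -/
theorem hasDerivAt_traceMoment (Y B : E →L[ℝ] E) (p : ℕ) (t : ℝ) :
    HasDerivAt (fun t : ℝ => traceMoment (p + 1) (Y + t • B))
      (opTrace E (B * (Y + t • B) ^ p) / p.factorial) t := by
  have h := ((opTrace E).hasFDerivAt.comp_hasDerivAt t
    ((hasDerivAt_line Y B t).fun_pow' (p + 1))).div_const ((p + 1).factorial : ℝ)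
  refine h.congr_deriv ?_
  have h1 : ∀ i ∈ Finset.range (p + 1),
      opTrace E ((Y + t • B) ^ ((p + 1).pred - i) * B * (Y + t • B) ^ i) =
        opTrace E (B * (Y + t • B) ^ p) := by
    intro i hi
    rw [mul_assoc, opTrace_mul_comm, mul_assoc, ← pow_add]
    congr 3
    have := Finset.mem_range.1 hi
    simp only [Nat.pred_succ]; omega
  rw [map_sum, Finset.sum_congr rfl h1, Finset.sum_const, Finset.card_range, Nat.factorial_succ]
  have : (p.factorial : ℝ) ≠ 0 := by positivity
  push_cast
  rw [nsmul_eq_mul]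
  push_cast
  field_simp

/-- The second derivative of the moment of order `2q + 2`. Cyclicity no longer merges its `2q + 1`
terms, but `opTrace_sandwich_le` bounds each of them by the same quantity, a multiple of the moment
two orders lower. -/
theorem exists_hasDerivAt_traceMoment_deriv {Y B : E →L[ℝ] E} (hY : IsSymm Y) (hB : IsSymm B)
    {L : ℝ} (hL : ‖B‖ ≤ L) (q : ℕ) (t : ℝ) :
    ∃ d ≤ L ^ 2 * traceMoment (2 * q) (Y + t • B),
      HasDerivAt (fun t : ℝ => opTrace E (B * (Y + t • B) ^ (2 * q + 1)) / (2 * q + 1).factorial)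
        d t := by
  have h := ((opTrace E).hasFDerivAt.comp_hasDerivAt t
    (((hasDerivAt_line Y B t).fun_pow' (2 * q + 1)).const_mul B)).div_const
      ((2 * q + 1).factorial : ℝ)
  refine ⟨_, ?_, h⟩
  have h1 : ∀ i ∈ Finset.range (2 * q + 1),
      opTrace E (B * ((Y + t • B) ^ ((2 * q + 1).pred - i) * B * (Y + t • B) ^ i)) ≤
        L ^ 2 * opTrace E ((Y + t • B) ^ (2 * q)) := by
    intro i hi
    have hi' := Finset.mem_range.1 hi
    have e1 : (2 * q + 1).pred - i + i = 2 * q := by simp only [Nat.pred_succ]; omega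
    have := opTrace_sandwich_le hB (hY.add (hB.smul t)) hL
      (j := (2 * q + 1).pred - i) (k := i) (by rw [e1]; exact even_two_mul q)
    rwa [e1] at this
  have h2 := Finset.sum_le_sum h1
  rw [Finset.sum_const, Finset.card_range, nsmul_eq_mul] at h2
  rw [Finset.mul_sum, map_sum, traceMoment, Nat.factorial_succ, div_le_iff₀ (by positivity)]
  refine h2.trans (le_of_eq ?_)
  have : ((2 * q).factorial : ℝ) ≠ 0 := by positivity
  push_cast
  field_simp

/-- A function on the line with vanishing initial value and slope stays nonpositive on `[0, ∞)` if
its second derivative is nonpositive there. -/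
theorem nonpos_of_second_deriv_nonpos {u u' : ℝ → ℝ} (h0 : u 0 ≤ 0) (h0' : u' 0 ≤ 0)
    (hu : ∀ t, HasDerivAt u (u' t) t) (hu' : ∀ t, 0 ≤ t → ∃ d ≤ 0, HasDerivAt u' d t) :
    ∀ t, 0 ≤ t → u t ≤ 0 := by
  have aux : ∀ v : ℝ → ℝ, v 0 ≤ 0 → (∀ t, 0 ≤ t → ∃ d ≤ 0, HasDerivAt v d t) →
      ∀ t, 0 ≤ t → v t ≤ 0 := by
    intro v hv0 hv t ht
    refine le_trans ?_ hv0
    refine antitoneOn_of_deriv_nonpos (convex_Ici (0 : ℝ)) ?_ ?_ ?_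
      (Set.mem_Ici.2 le_rfl) (Set.mem_Ici.2 ht) ht
    · intro s hs
      obtain ⟨d, -, hd⟩ := hv s hs
      exact hd.continuousAt.continuousWithinAt
    · intro s hs
      rw [interior_Ici] at hs
      obtain ⟨d, -, hd⟩ := hv s (le_of_lt hs)
      exact hd.differentiableAt.differentiableWithinAt
    · intro s hs
      rw [interior_Ici] at hs
      obtain ⟨d, h, hd⟩ := hv s (le_of_lt hs)
      rwa [hd.deriv]
  have h1 := aux u' h0' hu'
  exact aux u h0 fun t ht => ⟨u' t, h1 t ht, hu t⟩

/-- One step of the moment recursion: adding a centered random symmetric operator of norm at most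
`L`. -/
theorem sum_traceMoment_line_le {ι : Type*} [Fintype ι] {Y : E →L[ℝ] E} (hY : IsSymm Y)
    {X : ι → E →L[ℝ] E} (hX : ∀ j, IsSymm (X j)) {L : ℝ} (hL : ∀ j, ‖X j‖ ≤ L)
    (h0 : ∑ j, X j = 0) (q : ℕ) :
    ∀ t, 0 ≤ t → ∑ j, traceMoment (2 * q) (Y + t • X j) ≤
      Fintype.card ι * ∑ i ∈ Finset.range (q + 1),
        traceMoment (2 * (q - i)) Y * (L ^ (2 * i) * (t ^ (2 * i) / (2 * i).factorial)) := by
  induction q with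
  | zero =>
    intro t ht
    simp [traceMoment]
  | succ q ih =>
    set n : ℝ := (Fintype.card ι : ℝ) with hn
    set R' : ℝ → ℝ := fun t => n * ∑ i ∈ Finset.range (q + 1),
        traceMoment (2 * (q - i)) Y * (L ^ (2 * (i + 1)) * (t ^ (2 * i + 1) / (2 * i + 1).factorial))
    have hpow : ∀ (p : ℕ) (t : ℝ), HasDerivAt (fun t : ℝ => t ^ (p + 1) / (p + 1).factorial)
        (t ^ p / p.factorial) t := by
      intro p t
      refine ((hasDerivAt_pow (p + 1) t).div_const _).congr_deriv ?_
      rw [Nat.factorial_succ]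
      have : (p.factorial : ℝ) ≠ 0 := by positivity
      push_cast
      field_simp
    have hR : ∀ t, HasDerivAt (fun t => n * ∑ i ∈ Finset.range (q + 1 + 1),
        traceMoment (2 * (q + 1 - i)) Y * (L ^ (2 * i) * (t ^ (2 * i) / (2 * i).factorial)))
        (R' t) t := by
      intro t
      refine HasDerivAt.const_mul n ?_
      -- The term `i = 0` is constant in `t`; the others shift down by one index on differentiation.
      simp only [Finset.sum_range_succ' _ (q + 1)]
      rw [← add_zero (Finset.sum _ _)]
      refine HasDerivAt.add ?_ ?_
      · refine HasDerivAt.fun_sum fun i _ => ?_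
        rw [Nat.add_sub_add_right]
        exact ((hpow (2 * i + 1) t).const_mul _).const_mul _
      · simp only [mul_zero, pow_zero]
        exact hasDerivAt_const _ _
    have hR' : ∀ t, HasDerivAt R' (L ^ 2 * (n * ∑ i ∈ Finset.range (q + 1),
        traceMoment (2 * (q - i)) Y * (L ^ (2 * i) * (t ^ (2 * i) / (2 * i).factorial)))) t := by
      intro t
      have := HasDerivAt.const_mul n (HasDerivAt.fun_sum (u := Finset.range (q + 1)) fun i _ =>
        (((hpow (2 * i) t).const_mul (L ^ (2 * (i + 1)))).const_mul (traceMoment (2 * (q - i)) Y)))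
      refine this.congr_deriv ?_
      simp only [Finset.mul_sum]
      refine Finset.sum_congr rfl fun i _ => ?_
      ring
    -- The second derivative of the right side is `L²` times the right side for `q`, so the
    -- induction hypothesis compares second derivatives.
    have key := nonpos_of_second_deriv_nonpos
      (u := fun t => ∑ j, traceMoment (2 * (q + 1)) (Y + t • X j) -
        n * ∑ i ∈ Finset.range (q + 1 + 1),
        traceMoment (2 * (q + 1 - i)) Y * (L ^ (2 * i) * (t ^ (2 * i) / (2 * i).factorial)))
      (u' := fun t => ∑ j, opTrace E (X j * (Y + t • X j) ^ (2 * q + 1)) / (2 * q + 1).factorial -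
        R' t) ?_ ?_ ?_ ?_
    · intro t ht
      have := key t ht
      linarith
    · simp only [zero_smul, add_zero, Finset.sum_const, Finset.card_univ, nsmul_eq_mul]
      rw [Finset.sum_range_succ' _ (q + 1)]
      simp [n]
    · have hz : ∑ j, opTrace E (X j * (Y + (0 : ℝ) • X j) ^ (2 * q + 1)) / (2 * q + 1).factorial
          = 0 := by
        simp only [zero_smul, add_zero]
        rw [← Finset.sum_div, ← map_sum, ← Finset.sum_mul, h0]
        simp
      simp only [hz]
      simp [R']
    · intro t
      refine HasDerivAt.sub (HasDerivAt.fun_sum fun j _ => ?_) (hR t)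
      exact hasDerivAt_traceMoment Y (X j) (2 * q + 1) t
    · intro t ht
      choose d hd hd' using fun j => exists_hasDerivAt_traceMoment_deriv hY (hX j) (hL j) q t
      refine ⟨_, ?_, (HasDerivAt.fun_sum fun j _ => hd' j).sub (hR' t)⟩
      have h1 : ∑ j, d j ≤ L ^ 2 * ∑ j, traceMoment (2 * q) (Y + t • X j) := by
        rw [Finset.mul_sum]
        exact Finset.sum_le_sum fun j _ => hd j
      have h2 := mul_le_mul_of_nonneg_left (ih t ht) (sq_nonneg L)
      linarith

/-- The coefficientwise form of `cosh x ≤ exp(x²/2)`. -/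
theorem two_pow_mul_factorial_le (i : ℕ) : 2 ^ i * i.factorial ≤ (2 * i).factorial := by
  induction i with
  | zero => simp
  | succ i ih =>
    rw [show 2 * (i + 1) = 2 * i + 1 + 1 by ring, Nat.factorial_succ, Nat.factorial_succ,
      Nat.factorial_succ, pow_succ]
    calc 2 ^ i * 2 * ((i + 1) * i.factorial) = (2 * i + 2) * (2 ^ i * i.factorial) := by ring
      _ ≤ (2 * i + 1 + 1) * ((2 * i + 1) * (2 * i).factorial) := by
        refine Nat.mul_le_mul (by omega) ?_
        nlinarith [Nat.zero_le (2 * i * (2 * i).factorial)]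

/-- The line estimate at `t = 1`, weakened from hyperbolic-cosine to exponential coefficients so
that the bounds can be iterated by the binomial theorem. -/
theorem sum_traceMoment_add_le {ι : Type*} [Fintype ι] {Y : E →L[ℝ] E} (hY : IsSymm Y)
    {X : ι → E →L[ℝ] E} (hX : ∀ j, IsSymm (X j)) {L : ℝ} (hL : ∀ j, ‖X j‖ ≤ L)
    (h0 : ∑ j, X j = 0) (q : ℕ) :
    ∑ j, traceMoment (2 * q) (Y + X j) ≤
      Fintype.card ι * ∑ i ∈ Finset.range (q + 1),
        traceMoment (2 * (q - i)) Y * ((L ^ 2 / 2) ^ i / i.factorial) := by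
  have h := sum_traceMoment_line_le hY hX hL h0 q 1 zero_le_one
  simp only [one_smul, one_pow] at h
  refine h.trans (mul_le_mul_of_nonneg_left (Finset.sum_le_sum fun i _ => ?_) (Nat.cast_nonneg _))
  refine mul_le_mul_of_nonneg_left ?_ (traceMoment_nonneg hY _)
  rw [pow_mul, div_pow, div_div, mul_one_div]
  refine div_le_div_of_nonneg_left (by positivity) (by positivity) ?_
  exact_mod_cast two_pow_mul_factorial_le i

/-- Trace moments of the sum over a batch sampled uniformly with replacement. -/
theorem sum_batch_traceMoment_le {ι : Type*} [Fintype ι]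
    {X : ι → E →L[ℝ] E} (hX : ∀ j, IsSymm (X j)) {L : ℝ} (hL : ∀ j, ‖X j‖ ≤ L)
    (h0 : ∑ j, X j = 0) (s q : ℕ) :
    ∑ A : Fin s → ι, traceMoment (2 * q) (∑ r, X (A r)) ≤
      (Fintype.card ι : ℝ) ^ s * (Module.finrank ℝ E * ((s * (L ^ 2 / 2)) ^ q / q.factorial)) := by
  induction s generalizing q with
  | zero =>
    rcases Nat.eq_zero_or_pos q with rfl | hq
    · simp [traceMoment, opTrace_one]
    · simp [traceMoment, hq.ne']
  | succ s ih =>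
    -- The first draw is averaged out with the remaining ones fixed.
    rw [← (Fin.consEquiv fun _ => ι).sum_comp, Fintype.sum_prod_type, Finset.sum_comm]
    simp only [Fin.consEquiv_apply, Fin.sum_univ_succ, Fin.cons_zero, Fin.cons_succ]
    have h1 : ∀ A : Fin s → ι, ∑ j, traceMoment (2 * q) (X j + ∑ r, X (A r)) ≤
        Fintype.card ι * ∑ i ∈ Finset.range (q + 1),
        traceMoment (2 * (q - i)) (∑ r, X (A r)) * ((L ^ 2 / 2) ^ i / i.factorial) := fun A => by
      simp only [add_comm (X _)]
      exact sum_traceMoment_add_le (IsSymm.sum _ fun r => hX _) hX hL h0 q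
    refine (Finset.sum_le_sum fun A _ => h1 A).trans ?_
    rw [← Finset.mul_sum, Finset.sum_comm, pow_succ' (Fintype.card ι : ℝ) s, mul_assoc]
    refine mul_le_mul_of_nonneg_left ?_ (Nat.cast_nonneg _)
    simp only [← Finset.sum_mul]
    have h2 : ∀ i ∈ Finset.range (q + 1),
        (∑ A : Fin s → ι, traceMoment (2 * (q - i)) (∑ r, X (A r))) *
          ((L ^ 2 / 2) ^ i / i.factorial) ≤
        ((Fintype.card ι : ℝ) ^ s * (Module.finrank ℝ E *
          ((s * (L ^ 2 / 2)) ^ (q - i) / (q - i).factorial))) * ((L ^ 2 / 2) ^ i / i.factorial) :=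
      fun i _ => mul_le_mul_of_nonneg_right (ih (q - i)) (by positivity)
    refine (Finset.sum_le_sum h2).trans (le_of_eq ?_)
    -- The binomial theorem, read as `exp(u) exp(s u) = exp((s + 1) u)` at the coefficient of order
    -- `q`.
    have h3 : (((s + 1 : ℕ) : ℝ) * (L ^ 2 / 2)) ^ q / q.factorial =
        ∑ i ∈ Finset.range (q + 1), ((L ^ 2 / 2) ^ i / i.factorial) *
          ((s * (L ^ 2 / 2)) ^ (q - i) / (q - i).factorial) := by
      rw [show ((s + 1 : ℕ) : ℝ) * (L ^ 2 / 2) = L ^ 2 / 2 + s * (L ^ 2 / 2) by push_cast; ring,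
        add_pow, Finset.sum_div]
      refine Finset.sum_congr rfl fun i hi => ?_
      have hi' : i ≤ q := Nat.lt_succ_iff.1 (Finset.mem_range.1 hi)
      rw [Nat.cast_choose ℝ hi']
      have : (q.factorial : ℝ) ≠ 0 := by positivity
      field_simp
    rw [h3, Finset.mul_sum, Finset.mul_sum]
    refine Finset.sum_congr rfl fun i _ => ?_
    ring

end TraceMoments

/-! ### Hoeffding inequalities for uniform batches of operators and vectors. -/

section Concentration

variable {E : Type*} [NormedAddCommGroup E] [InnerProductSpace ℝ E] [FiniteDimensional ℝ E]

theorem factorial_two_mul_le (q : ℕ) : (2 * q).factorial ≤ q.factorial * (2 * q) ^ q := by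
  rw [two_mul, ← Nat.factorial_mul_ascFactorial]
  exact Nat.mul_le_mul_left _ (Nat.ascFactorial_le_pow_add q q)

/-- Markov's inequality for the trace moments of a batch sum. -/
theorem card_batch_norm_gt_mul_le {ι : Type*} [Fintype ι]
    {X : ι → E →L[ℝ] E} (hX : ∀ j, IsSymm (X j)) {L : ℝ} (hL : ∀ j, ‖X j‖ ≤ L)
    (h0 : ∑ j, X j = 0) (s : ℕ) {q : ℕ} (hq : q ≠ 0) {t : ℝ} (ht : 0 ≤ t) :
    (Nat.card {A : Fin s → ι | t < ‖∑ r, X (A r)‖} : ℝ) * t ^ (2 * q) ≤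
      (Fintype.card ι : ℝ) ^ s * (Module.finrank ℝ E * (q * s * L ^ 2) ^ q) := by
  classical
  -- The even trace moment dominates the power of the norm, by contraposition of
  -- `norm_le_of_opTrace_le`.
  have h1 : ∀ A : Fin s → ι, (if t < ‖∑ r, X (A r)‖ then t ^ (2 * q) else 0) ≤
      (2 * q).factorial * traceMoment (2 * q) (∑ r, X (A r)) := fun A => by
    have hS : IsSymm (∑ r, X (A r)) := IsSymm.sum _ fun r => hX _
    split_ifs with h
    · by_contra! hc
      refine absurd (norm_le_of_opTrace_le hS ht hq ?_) (not_le.2 h)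
      rw [traceMoment, mul_div_cancel₀ _ (by positivity)] at hc
      exact hc.le
    · exact mul_nonneg (by positivity) (traceMoment_nonneg hS q)
  have h2 := Finset.sum_le_sum fun A (_ : A ∈ Finset.univ) => h1 A
  rw [← Finset.mul_sum, ← Finset.sum_filter, Finset.sum_const, nsmul_eq_mul] at h2
  have h3 : Nat.card {A : Fin s → ι | t < ‖∑ r, X (A r)‖} =
      (Finset.univ.filter fun A : Fin s → ι => t < ‖∑ r, X (A r)‖).card :=
    Nat.subtype_card _ (by simp)
  rw [h3]
  refine h2.trans ((mul_le_mul_of_nonneg_left (sum_batch_traceMoment_le hX hL h0 s q)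
    (by positivity)).trans ?_)
  rw [mul_left_comm, mul_left_comm _ (Module.finrank ℝ E : ℝ)]
  refine mul_le_mul_of_nonneg_left (mul_le_mul_of_nonneg_left ?_ (by positivity)) (by positivity)
  rw [← mul_div_assoc, div_le_iff₀ (by positivity)]
  have h4 : ((2 * q).factorial : ℝ) ≤ q.factorial * (2 * q) ^ q := by
    exact_mod_cast factorial_two_mul_le q
  refine (mul_le_mul_of_nonneg_right h4 (by positivity)).trans (le_of_eq ?_)
  rw [mul_assoc, ← mul_pow, mul_comm]
  congr 2
  ring

/-- Matrix Hoeffding inequality for batches sampled uniformly with replacement, in counting form,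
for symmetric operators. -/
theorem card_batch_norm_gt_le {ι : Type*} [Fintype ι]
    {X : ι → E →L[ℝ] E} (hX : ∀ j, IsSymm (X j)) {L : ℝ} (hL : ∀ j, ‖X j‖ ≤ L)
    (h0 : ∑ j, X j = 0) {s : ℕ} (hs : 0 < s) {δ : ℝ} (hδ : 0 < δ)
    (hl : 1 ≤ Real.log (Module.finrank ℝ E / δ)) :
    (Nat.card {A : Fin s → ι | √(6 * Real.log (Module.finrank ℝ E / δ) * s) * L <
      ‖∑ r, X (A r)‖} : ℝ) ≤ (Fintype.card ι : ℝ) ^ s * δ := by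
  set l := Real.log (Module.finrank ℝ E / δ) with hl_def
  have hd : (0 : ℝ) < Module.finrank ℝ E / δ := by
    rcases (div_nonneg (Nat.cast_nonneg _) hδ.le : (0 : ℝ) ≤ Module.finrank ℝ E / δ).eq_or_lt
      with h | h
    · rw [hl_def, ← h, Real.log_zero] at hl
      linarith
    · exact h
  rcases isEmpty_or_nonempty ι with hι | ⟨⟨j₀⟩⟩
  · have : IsEmpty (Fin s → ι) := ⟨fun A => hι.elim (A ⟨0, hs⟩)⟩
    rw [Nat.card_of_isEmpty, Nat.cast_zero]
    positivity
  have hL0 : 0 ≤ L := (norm_nonneg _).trans (hL j₀)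
  -- For `L = 0` every batch sum vanishes; otherwise the factor `(q s L²)^q` can be cancelled.
  rcases hL0.eq_or_lt with hz | hpos
  · subst hz
    have : ∀ j, X j = 0 := fun j => norm_le_zero_iff.1 (hL j)
    simp only [this, Finset.sum_const_zero, norm_zero, mul_zero, lt_irrefl, Set.ofPred_false]
    rw [Nat.card_of_isEmpty, Nat.cast_zero]
    positivity
  -- Since `l ≥ 1`, this gives `l ≤ q ≤ 2l`. The squared threshold `6 l s L²` is then at least `3 q
  -- s L²`, so the Markov bound is at most `d 3^(-q) ≤ d exp(-l) = δ`, where `d` is the dimension.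
  set q := ⌈l⌉₊ with hq_def
  have hq0 : q ≠ 0 := (Nat.ceil_pos.2 (by linarith)).ne'
  have hql : (q : ℝ) ≤ 2 * l := by
    have := Nat.ceil_lt_add_one (a := l) (by linarith)
    linarith
  have hlq : l ≤ q := Nat.le_ceil l
  have hs' : (0 : ℝ) < s := Nat.cast_pos.2 hs
  have h := card_batch_norm_gt_mul_le hX hL h0 s hq0
    (t := √(6 * l * s) * L) (by positivity)
  set c : ℝ := (Nat.card {A : Fin s → ι | √(6 * l * s) * L < ‖∑ r, X (A r)‖} : ℝ)
  have ht : (√(6 * l * s) * L) ^ (2 * q) = (6 * l * s * L ^ 2) ^ q := by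
    rw [pow_mul, mul_pow, Real.sq_sqrt (by positivity)]
  rw [ht] at h
  have h1 : 3 ^ q * (q * s * L ^ 2 : ℝ) ^ q ≤ (6 * l * s * L ^ 2) ^ q := by
    rw [← mul_pow]
    refine pow_le_pow_left₀ (by positivity) ?_ q
    have := mul_le_mul_of_nonneg_right hql (by positivity : (0 : ℝ) ≤ 3 * s * L ^ 2)
    linarith
  have hQ : (0 : ℝ) < (q * s * L ^ 2) ^ q := by
    have : (0 : ℝ) < q := Nat.cast_pos.2 (Nat.pos_of_ne_zero hq0)
    positivity
  have h2 : c * 3 ^ q ≤ (Fintype.card ι : ℝ) ^ s * Module.finrank ℝ E := by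
    refine le_of_mul_le_mul_right ?_ hQ
    have := mul_le_mul_of_nonneg_left h1 (Nat.cast_nonneg _ : 0 ≤ c)
    linarith
  have h3 : (Module.finrank ℝ E : ℝ) ≤ δ * 3 ^ q := by
    have h4 : Real.exp l ≤ 3 ^ q := by
      calc Real.exp l ≤ Real.exp q := Real.exp_le_exp.2 hlq
        _ = Real.exp 1 ^ q := by rw [← Real.exp_nat_mul, mul_one]
        _ ≤ 3 ^ q := pow_le_pow_left₀ (Real.exp_pos _).le (by
            have := Real.exp_one_lt_d9; linarith) q
    rw [hl_def, Real.exp_log hd, div_le_iff₀ hδ] at h4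
    linarith
  refine le_of_mul_le_mul_right (h2.trans ?_) (by positivity : (0 : ℝ) < 3 ^ q)
  rw [mul_assoc]
  exact mul_le_mul_of_nonneg_left h3 (by positivity)

variable {F G : Type*} [NormedAddCommGroup F] [InnerProductSpace ℝ F] [FiniteDimensional ℝ F]
  [NormedAddCommGroup G] [InnerProductSpace ℝ G] [FiniteDimensional ℝ G]

/-- The self-adjoint dilation `(v, w) ↦ (X† w, X v)` of an operator `X`. -/
noncomputable def dilation : (F →L[ℝ] G) →+ (WithLp 2 (F × G) →L[ℝ] WithLp 2 (F × G)) :=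
  AddMonoidHom.mk' (fun X =>
    (WithLp.prodContinuousLinearEquiv 2 ℝ F G).symm.toContinuousLinearMap ∘L
      ((X.adjoint ∘L ContinuousLinearMap.snd ℝ F G).prod (X ∘L ContinuousLinearMap.fst ℝ F G)) ∘L
      (WithLp.prodContinuousLinearEquiv 2 ℝ F G).toContinuousLinearMap) fun X Y => by
    ext1 x
    simp only [map_add]
    rfl

theorem dilation_apply (X : F →L[ℝ] G) (x : WithLp 2 (F × G)) :
    dilation X x = WithLp.toLp 2 (X.adjoint x.snd, X x.fst) := rfl

theorem isSymm_dilation (X : F →L[ℝ] G) : IsSymm (dilation X) := by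
  intro x y
  simp only [ContinuousLinearMap.coe_coe, dilation_apply, WithLp.prod_inner_apply]
  simp only [WithLp.ofLp_fst, WithLp.ofLp_snd, ContinuousLinearMap.adjoint_inner_left,
    ContinuousLinearMap.adjoint_inner_right]
  ring

theorem norm_dilation_le (X : F →L[ℝ] G) : ‖dilation X‖ ≤ ‖X‖ := by
  refine ContinuousLinearMap.opNorm_le_bound _ (norm_nonneg X) fun x => ?_
  refine le_of_sq_le_sq ?_ (by positivity)
  rw [mul_pow, WithLp.prod_norm_sq_eq_of_L2, WithLp.prod_norm_sq_eq_of_L2, dilation_apply]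
  have h1 : ‖X.adjoint x.snd‖ ≤ ‖X‖ * ‖x.snd‖ := by
    simpa using X.adjoint.le_opNorm x.snd
  have h2 := pow_le_pow_left₀ (norm_nonneg _) h1 2
  have h3 := pow_le_pow_left₀ (norm_nonneg _) (X.le_opNorm x.fst) 2
  simp only [mul_pow] at h2 h3
  change ‖X.adjoint x.snd‖ ^ 2 + ‖X x.fst‖ ^ 2 ≤ _
  linarith

theorem norm_le_norm_dilation (X : F →L[ℝ] G) : ‖X‖ ≤ ‖dilation X‖ := by
  refine ContinuousLinearMap.opNorm_le_bound _ (dilation X).opNorm_nonneg fun v => ?_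
  have h := (dilation X).le_opNorm (WithLp.toLp 2 (v, 0))
  rw [dilation_apply, WithLp.prod_norm_eq_of_L2, WithLp.prod_norm_eq_of_L2] at h
  simpa using h

theorem norm_dilation (X : F →L[ℝ] G) : ‖dilation X‖ = ‖X‖ :=
  le_antisymm (norm_dilation_le X) (norm_le_norm_dilation X)

theorem finrank_withLp_prod :
    Module.finrank ℝ (WithLp 2 (F × G)) = Module.finrank ℝ F + Module.finrank ℝ G := by
  rw [(WithLp.linearEquiv 2 ℝ (F × G)).finrank_eq, Module.finrank_prod]

instance isProbabilityMeasure_uniformOn_fin (N : ℕ) [NeZero N] :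
    IsProbabilityMeasure (uniformOn (Set.univ : Set (Fin N))) :=
  isProbabilityMeasure_uniformOn Set.finite_univ Set.univ_nonempty

instance isProbabilityMeasure_batchLaw (N s : ℕ) [NeZero N] :
    IsProbabilityMeasure (batchLaw N s) := by
  unfold batchLaw; infer_instance

/-- A batch is uniformly distributed on the set of all batches. -/
theorem batchLaw_apply {N s : ℕ} [NeZero N] (B : Set (Fin s → Fin N)) :
    batchLaw N s B = ENNReal.ofReal (Nat.card B / (N : ℝ) ^ s) := by
  classical
  have hN : (0 : ℝ) < N := Nat.cast_pos.2 (NeZero.pos N)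
  have h1 : ∀ A : Fin s → Fin N, batchLaw N s {A} = ((N : ENNReal)⁻¹) ^ s := fun A => by
    rw [batchLaw, ← Set.univ_pi_singleton, Measure.pi_pi]
    simp [uniformOn_univ, div_eq_mul_inv]
  have hB : B = ((Finset.univ.filter (· ∈ B) : Finset (Fin s → Fin N)) : Set (Fin s → Fin N)) := by
    ext; simp
  have h2 : Nat.card B = (Finset.univ.filter (· ∈ B) : Finset (Fin s → Fin N)).card := by
    exact Nat.subtype_card _ (by simp)
  rw [h2]
  conv_lhs => rw [hB]
  rw [← sum_measure_singleton]
  simp only [h1, Finset.sum_const, nsmul_eq_mul]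
  rw [ENNReal.ofReal_div_of_pos (by positivity), ENNReal.ofReal_natCast,
    ENNReal.ofReal_pow hN.le, ENNReal.ofReal_natCast, div_eq_mul_inv, ENNReal.inv_pow]

/-- Matrix Hoeffding inequality for the mean over a batch sampled uniformly with replacement. -/
theorem batchLaw_norm_mean_gt_le {m n N s : ℕ} [NeZero N] (hs : 0 < s) {X : Fin N → Jac n m}
    {L : ℝ} (hL : ∀ j, ‖X j‖ ≤ L) (h0 : ∑ j, X j = 0) {δ : ℝ} (hδ : 0 < δ)
    (hl : 1 ≤ Real.log ((m + n) / δ)) :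
    batchLaw N s {A | √(6 * Real.log ((m + n) / δ) / s) * L < ‖(s : ℝ)⁻¹ • ∑ r, X (A r)‖} ≤
      ENNReal.ofReal δ := by
  have hd : ((Module.finrank ℝ (WithLp 2 (Vec n × Vec m)) : ℕ) : ℝ) = m + n := by
    rw [finrank_withLp_prod]; simp [add_comm]
  have hs' : (0 : ℝ) < s := Nat.cast_pos.2 hs
  have hN : (0 : ℝ) < N := Nat.cast_pos.2 (NeZero.pos N)
  have h := card_batch_norm_gt_le (X := fun j => dilation (X j)) (fun j => isSymm_dilation _)
    (fun j => (norm_dilation_le _).trans (hL j)) (by rw [← map_sum, h0, map_zero]) hs hδ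
    (by rwa [hd])
  rw [hd] at h
  simp only [← map_sum, norm_dilation, Fintype.card_fin] at h
  rw [batchLaw_apply]
  refine ENNReal.ofReal_le_ofReal ?_
  rw [div_le_iff₀ (by positivity), mul_comm δ]
  have hr : √(6 * Real.log ((m + n) / δ) / s) * s = √(6 * Real.log ((m + n) / δ) * s) := by
    conv_lhs => rw [← Real.sqrt_sq hs'.le, ← Real.sqrt_mul' _ (sq_nonneg _)]
    congr 1
    rw [Real.sqrt_sq hs'.le]
    field_simp
  have hB : {A : Fin s → Fin N | √(6 * Real.log ((m + n) / δ) / s) * L <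
      ‖(s : ℝ)⁻¹ • ∑ r, X (A r)‖} =
      {A | √(6 * Real.log ((m + n) / δ) * s) * L < ‖∑ r, X (A r)‖} := by
    ext A
    rw [Set.mem_ofPred_eq, Set.mem_ofPred_eq, norm_smul, Real.norm_of_nonneg (by positivity),
      ← div_eq_inv_mul, lt_div_iff₀ hs', mul_right_comm, hr]
  rw [hB]
  exact h

/-- Vector version of the Hoeffding inequality. -/
theorem batchLaw_norm_mean_vec_gt_le {m N s : ℕ} [NeZero N] (hs : 0 < s) {X : Fin N → Vec m}
    {L : ℝ} (hL : ∀ j, ‖X j‖ ≤ L) (h0 : ∑ j, X j = 0) {δ : ℝ} (hδ : 0 < δ)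
    (hl : 1 ≤ Real.log ((m + 1) / δ)) :
    batchLaw N s {A | √(6 * Real.log ((m + 1) / δ) / s) * L < ‖(s : ℝ)⁻¹ • ∑ r, X (A r)‖} ≤
      ENNReal.ofReal δ := by
  let e : Vec 1 := EuclideanSpace.single 0 1
  have he : ‖e‖ = 1 := by simp [e]
  -- Vectors embed isometrically as operators on a line, which accounts for the dimension factor `m
  -- + 1`.
  let T : Vec m →ₗ[ℝ] Jac 1 m :=
    { toFun := fun v => (innerSL ℝ e).smulRight v
      map_add' := fun v w => by ext x; simp
      map_smul' := fun c v => by ext x; simp; ring }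
  have hT : ∀ v, ‖T v‖ = ‖v‖ := fun v => by
    change ‖(innerSL ℝ e).smulRight v‖ = _
    rw [ContinuousLinearMap.norm_smulRight_apply, innerSL_apply_norm, he, one_mul]
  have h := batchLaw_norm_mean_gt_le (m := m) (n := 1) (N := N) hs (X := fun j => T (X j))
    (fun j => (hT _).trans_le (hL j)) (by rw [← map_sum, h0, map_zero]) hδ (by simpa using hl)
  simpa only [← map_sum, ← map_smul, hT, Nat.cast_one] using h

end Concentration

/-! ### Deterministic analysis of prox-linear models: existence, growth and descent. -/

namespace ProxLinear

/-- The mean value inequality on the segment gives `L` where integration would give `L/2`; the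
margin `5 lf Lg < M` makes the cruder constant sufficient. -/
theorem norm_sub_sub_fderiv_le {m n : ℕ} {G : Vec n → Vec m} (hG : Differentiable ℝ G) {L : ℝ≥0}
    (hL : LipschitzWith L fun x => fderiv ℝ G x) (x y : Vec n) :
    ‖G y - G x - fderiv ℝ G x (y - x)‖ ≤ L * ‖y - x‖ ^ 2 := by
  have h := (convex_segment x y).norm_image_sub_le_of_norm_hasFDerivWithin_le' (f := G)
    (f' := fun z => fderiv ℝ G z) (φ := fderiv ℝ G x) (C := L * ‖y - x‖)
    (fun z _ => (hG z).hasFDerivAt.hasFDerivWithinAt) (fun z hz => ?_)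
    (left_mem_segment ℝ x y) (right_mem_segment ℝ x y)
  · rw [sq, ← mul_assoc]; exact h
  · refine (hL.norm_sub_le z x).trans (mul_le_mul_of_nonneg_left ?_ L.2)
    have := norm_sub_le_of_mem_segment hz
    exact this

theorem norm_convex_comb_sq {n : ℕ} (a b : Vec n) (t : ℝ) :
    ‖(1 - t) • a + t • b‖ ^ 2 = (1 - t) * ‖a‖ ^ 2 + t * ‖b‖ ^ 2 - t * (1 - t) * ‖b - a‖ ^ 2 := by
  rw [norm_add_sq_real, norm_sub_sq_real, norm_smul, norm_smul, mul_pow, mul_pow,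
    inner_smul_left, inner_smul_right, Real.norm_eq_abs, Real.norm_eq_abs, sq_abs, sq_abs,
    real_inner_comm b a]
  simp
  ring

variable {m n N : ℕ} {f : Vec m → ℝ} {g : Fin N → Vec n → Vec m} {h : Vec n → EReal}
  {lf Lg : ℝ≥0} {M : ℝ}

theorem IsClosedConvexProper.coe_toReal (hh : IsClosedConvexProper h) {x : Vec n}
    (hx : h x ≠ ⊤) : ((h x).toReal : EReal) = h x :=
  EReal.coe_toReal hx (hh.ne_bot x)

theorem IsClosedConvexProper.convex_comb (hh : IsClosedConvexProper h) {x y : Vec n}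
    (hx : h x ≠ ⊤) (hy : h y ≠ ⊤) {t : ℝ} (ht : 0 ≤ t) (ht1 : t ≤ 1) :
    h ((1 - t) • x + t • y) ≠ ⊤ ∧
    (h ((1 - t) • x + t • y)).toReal ≤ (1 - t) * (h x).toReal + t * (h y).toReal := by
  have h1 := hh.convex (x := (x, (h x).toReal)) (by simp [hh.coe_toReal hx])
    (y := (y, (h y).toReal)) (by simp [hh.coe_toReal hy]) (sub_nonneg.2 ht1) ht (by ring)
  change h ((1 - t) • x + t • y) ≤ (((1 - t) * (h x).toReal + t * (h y).toReal : ℝ) : EReal) at h1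
  have h2 : h ((1 - t) • x + t • y) ≠ ⊤ := (h1.trans_lt (EReal.coe_lt_top _)).ne
  refine ⟨h2, ?_⟩
  rw [← hh.coe_toReal h2] at h1
  exact_mod_cast h1

/-- The finite part of the proximal linearized model. -/
noncomputable def smoothModel (f : Vec m → ℝ) (M : ℝ) (u : Vec m) (J : Jac n m) (x y : Vec n) : ℝ :=
  f (u + J (y - x)) + M / 2 * ‖y - x‖ ^ 2

theorem subproblem_eq (hh : IsClosedConvexProper h) (u : Vec m) (J : Jac n m) (x : Vec n)
    {y : Vec n} (hy : h y ≠ ⊤) :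
    subproblem f h M u J x y = ((smoothModel f M u J x y + (h y).toReal : ℝ) : EReal) := by
  rw [subproblem, ← hh.coe_toReal hy, EReal.toReal_coe, ← EReal.coe_add]; rfl

theorem ne_top_of_subproblem_le {u : Vec m} {J : Jac n m} {x y : Vec n} {v : ℝ}
    (hy : subproblem f h M u J x y ≤ v) : h y ≠ ⊤ := by
  intro hc
  rw [subproblem, hc, EReal.coe_add_top] at hy
  exact absurd hy (not_le.2 (EReal.coe_lt_top v))

/-- Strong convexity of modulus `M`: the term in `f` is a convex function of an affine map, and the
squared distance satisfies an exact identity along segments. -/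
theorem smoothModel_convex_comb (hf : ConvexOn ℝ Set.univ f) (u : Vec m) (J : Jac n m)
    (x y z : Vec n) {t : ℝ} (ht : 0 ≤ t) (ht1 : t ≤ 1) :
    smoothModel f M u J x ((1 - t) • y + t • z) ≤
      (1 - t) * smoothModel f M u J x y + t * smoothModel f M u J x z -
        M / 2 * (t * (1 - t) * ‖z - y‖ ^ 2) := by
  have e1 : (1 - t) • y + t • z - x = (1 - t) • (y - x) + t • (z - x) := by
    module
  have e2 : u + J ((1 - t) • (y - x) + t • (z - x)) =
      (1 - t) • (u + J (y - x)) + t • (u + J (z - x)) := by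
    rw [map_add, map_smul, map_smul]; module
  have h1 := hf.2 (Set.mem_univ (u + J (y - x))) (Set.mem_univ (u + J (z - x)))
    (sub_nonneg.2 ht1) ht (by ring)
  rw [smul_eq_mul, smul_eq_mul] at h1
  rw [smoothModel, e1, norm_convex_comb_sq, e2, smoothModel, smoothModel, sub_sub_sub_cancel_right]
  linarith

/-- A minimizer of the model satisfies the quadratic growth condition. -/
theorem quadratic_growth (hf : ConvexOn ℝ Set.univ f) (hh : IsClosedConvexProper h)
    {u : Vec m} {J : Jac n m} {x y : Vec n}
    (hy : ∀ z, subproblem f h M u J x y ≤ subproblem f h M u J x z) :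
    h y ≠ ⊤ ∧ ∀ z, h z ≠ ⊤ → smoothModel f M u J x y + (h y).toReal + M / 2 * ‖z - y‖ ^ 2 ≤
      smoothModel f M u J x z + (h z).toReal := by
  obtain ⟨w, hw⟩ := hh.exists_ne_top
  have hyt : h y ≠ ⊤ := ne_top_of_subproblem_le ((hy w).trans_eq (subproblem_eq hh u J x hw))
  refine ⟨hyt, fun z hz => ?_⟩
  -- Minimality is tested at the point `(1 - t) y + t z`, the inequality is divided by `t`, and `t`
  -- then tends to `0`.
  have key : ∀ t : ℝ, 0 < t → t ≤ 1 →
      smoothModel f M u J x y + (h y).toReal + M / 2 * ((1 - t) * ‖z - y‖ ^ 2) ≤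
      smoothModel f M u J x z + (h z).toReal := by
    intro t ht ht1
    obtain ⟨h1, h2⟩ := hh.convex_comb hyt hz ht.le ht1
    have h3 := hy ((1 - t) • y + t • z)
    rw [subproblem_eq hh u J x hyt, subproblem_eq hh u J x h1, EReal.coe_le_coe_iff] at h3
    have h4 := smoothModel_convex_comb (M := M) hf u J x y z ht.le ht1
    refine le_of_mul_le_mul_left ?_ ht
    linarith
  have hlim : Filter.Tendsto (fun t : ℝ => smoothModel f M u J x y + (h y).toReal +
      M / 2 * ((1 - t) * ‖z - y‖ ^ 2)) (nhdsWithin 0 (Set.Ioi 0))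
      (nhds (smoothModel f M u J x y + (h y).toReal + M / 2 * ((1 - 0) * ‖z - y‖ ^ 2))) := by
    refine Filter.Tendsto.mono_left (Continuous.tendsto (by fun_prop) 0) nhdsWithin_le_nhds
  rw [sub_zero, one_mul] at hlim
  refine le_of_tendsto hlim ?_
  filter_upwards [Ioc_mem_nhdsGT (zero_lt_one' ℝ)] with t ht
  exact key t ht.1 ht.2

theorem exists_iInf_objective_eq (hh : IsClosedConvexProper h)
    (hbdd : ⊥ < ⨅ x, objective f g h x) :
    ∃ φ : ℝ, (⨅ x, objective f g h x) = φ ∧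
      ∀ x, h x ≠ ⊤ → φ ≤ f (average g x) + (h x).toReal := by
  obtain ⟨w, hw⟩ := hh.exists_ne_top
  have hobj : ∀ x, h x ≠ ⊤ →
      objective f g h x = ((f (average g x) + (h x).toReal : ℝ) : EReal) := fun x hx => by
    rw [objective, EReal.coe_add, hh.coe_toReal hx]
  have h1 : (⨅ x, objective f g h x) ≠ ⊤ :=
    ((iInf_le _ w).trans_lt ((hobj w hw).trans_lt (EReal.coe_lt_top _))).ne
  refine ⟨(⨅ x, objective f g h x).toReal, (EReal.coe_toReal h1 hbdd.ne').symm, fun x hx => ?_⟩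
  have h2 := iInf_le (fun x => objective f g h x) x
  rw [← EReal.coe_toReal h1 hbdd.ne', hobj x hx, EReal.coe_le_coe_iff] at h2
  exact h2

theorem lowerSemicontinuous_subproblem (hf : Continuous f) (hh : IsClosedConvexProper h)
    (u : Vec m) (J : Jac n m) (x : Vec n) : LowerSemicontinuous (subproblem f h M u J x) := by
  refine LowerSemicontinuous.add' (Continuous.lowerSemicontinuous ?_) hh.closed fun y => ?_
  · exact continuous_coe_real_ereal.comp (by fun_prop)
  · exact EReal.continuousAt_add (Or.inl (EReal.coe_ne_top _)) (Or.inl (EReal.coe_ne_bot _))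

/-- A lower bound for `Φ` bounds `h` below by a constant minus `f ∘ g`, and the latter grows at most
linearly. The quadratic term therefore makes the model coercive, and a lower semicontinuous function
attains its minimum on a compact ball. -/
theorem exists_minimizer_subproblem (hM : 0 < M) (hA : StandingAssumptions f g h lf Lg)
    (hbdd : ⊥ < ⨅ x, objective f g h x) (u : Vec m) (J : Jac n m) (x : Vec n) :
    ∃ y, ∀ z, subproblem f h M u J x y ≤ subproblem f h M u J x z := by
  have hh := hA.h_closedConvexProper
  obtain ⟨w, hw⟩ := hh.exists_ne_top
  obtain ⟨φ, -, hφ⟩ := exists_iInf_objective_eq hh hbdd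
  obtain ⟨lg, hlg⟩ := hA.g_lipschitz
  set v := smoothModel f M u J x w + (h w).toReal with hv
  set c : ℝ := lf * ‖J‖ + lf * lg
  set c₀ : ℝ := f u + φ - f (average g x)
  have hlow : ∀ z, h z ≠ ⊤ →
      M / 2 * ‖z - x‖ ^ 2 - c * ‖z - x‖ + c₀ ≤ smoothModel f M u J x z + (h z).toReal := by
    intro z hz
    have h1 := hφ z hz
    have h2 : f (average g z) - f (average g x) ≤ lf * (lg * ‖z - x‖) :=
      (le_abs_self _).trans ((hA.f_lipschitz.norm_sub_le _ _).trans
        (mul_le_mul_of_nonneg_left (hlg.norm_sub_le _ _) lf.2))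
    have h3 : f u - f (u + J (z - x)) ≤ lf * (‖J‖ * ‖z - x‖) := by
      refine (le_abs_self _).trans ((hA.f_lipschitz.norm_sub_le _ _).trans
        (mul_le_mul_of_nonneg_left ?_ lf.2))
      rw [sub_add_cancel_left, norm_neg]
      exact J.le_opNorm _
    rw [smoothModel]
    simp only [c, c₀]
    nlinarith
  -- With `r = ‖z - x‖`, beyond this radius `(M/2) r² - c r ≥ r ≥ v - c₀`, so points outside cannot
  -- beat `w`, which lies inside.
  set R : ℝ := max ‖w - x‖ (2 * (c + 1) / M + |v - c₀|) with hR
  have hc : 0 ≤ c := by positivity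
  have hfar : ∀ z, h z ≠ ⊤ → R < ‖z - x‖ → v ≤ smoothModel f M u J x z + (h z).toReal := by
    intro z hz hzR
    refine le_trans ?_ (hlow z hz)
    have h1 : 2 * (c + 1) / M + |v - c₀| ≤ ‖z - x‖ := (le_max_right _ _).trans hzR.le
    have h2 : 2 * (c + 1) / M ≤ ‖z - x‖ := le_trans (by linarith [abs_nonneg (v - c₀)]) h1
    have h3 : v - c₀ ≤ ‖z - x‖ := by
      have : 0 ≤ 2 * (c + 1) / M := by positivity
      linarith [le_abs_self (v - c₀)]
    rw [div_le_iff₀ hM] at h2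
    nlinarith [norm_nonneg (z - x)]
  obtain ⟨y, hyR, hy⟩ := LowerSemicontinuousOn.exists_isMinOn
    (s := Metric.closedBall x R) (f := subproblem f h M u J x)
    ⟨w, by rw [mem_closedBall_iff_norm]; exact le_max_left _ _⟩
    (isCompact_closedBall x R)
    ((lowerSemicontinuous_subproblem hA.f_lipschitz.continuous hh u J x).lowerSemicontinuousOn _)
  refine ⟨y, fun z => ?_⟩
  by_cases hz : h z = ⊤
  · rw [subproblem, subproblem, hz, EReal.coe_add_top]; exact le_top
  rcases le_or_gt ‖z - x‖ R with hzR | hzR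
  · exact hy (mem_closedBall_iff_norm.2 hzR)
  · have h1 : subproblem f h M u J x y ≤ subproblem f h M u J x w :=
      hy (mem_closedBall_iff_norm.2 (le_max_left _ _))
    refine h1.trans ?_
    rw [subproblem_eq hh u J x hw, subproblem_eq hh u J x hz, EReal.coe_le_coe_iff]
    exact hfar z hz hzR

theorem existsUnique_isProxLinearStep (hM : 0 < M) (hA : StandingAssumptions f g h lf Lg)
    (hbdd : ⊥ < ⨅ x, objective f g h x) (x : Vec n) : ∃! y, IsProxLinearStep f g h M x y := by
  obtain ⟨y, hy⟩ := exists_minimizer_subproblem hM hA hbdd (average g x)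
    (fderiv ℝ (average g) x) x
  refine ⟨y, hy, fun z hz => ?_⟩
  obtain ⟨hyt, hq⟩ := quadratic_growth hA.f_convex hA.h_closedConvexProper hy
  obtain ⟨hzt, hq'⟩ := quadratic_growth hA.f_convex hA.h_closedConvexProper hz
  have h1 := hq z hzt
  have h2 := hq' y hyt
  rw [norm_sub_rev] at h2
  have h3 : M * ‖z - y‖ ^ 2 ≤ 0 := by linarith
  have h4 : ‖z - y‖ ^ 2 ≤ 0 := nonpos_of_mul_nonpos_right h3 hM
  have h5 : ‖z - y‖ = 0 := by nlinarith [norm_nonneg (z - y)]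
  exact sub_eq_zero.1 (norm_eq_zero.1 h5)

theorem isProxLinearStep_proxLinearStep (hM : 0 < M) (hA : StandingAssumptions f g h lf Lg)
    (hbdd : ⊥ < ⨅ x, objective f g h x) (x : Vec n) :
    IsProxLinearStep f g h M x (proxLinearStep f g h M x) :=
  Classical.epsilon_spec (existsUnique_isProxLinearStep hM hA hbdd x).exists

theorem differentiable_average (hg : ∀ j, Differentiable ℝ (g j)) :
    Differentiable ℝ (average g) := by
  unfold average
  exact (Differentiable.fun_sum fun j _ => hg j).const_smul (N : ℝ)⁻¹

theorem fderiv_average (hg : ∀ j, Differentiable ℝ (g j)) (x : Vec n) :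
    fderiv ℝ (average g) x = (N : ℝ)⁻¹ • ∑ j, fderiv ℝ (g j) x := by
  unfold average
  exact ((HasFDerivAt.fun_sum fun j _ => (hg j x).hasFDerivAt).const_smul (N : ℝ)⁻¹).fderiv

/-- Decrease of the objective along an inexact step computed from inexact estimates. -/
theorem objective_descent (hM : 0 < M) (hA : StandingAssumptions f g h lf Lg)
    (hbdd : ⊥ < ⨅ x, objective f g h x) {x y : Vec n} (hx : h x ≠ ⊤) {u : Vec m} {J : Jac n m}
    {eg eJ εbar : ℝ} (hu : ‖u - average g x‖ ≤ eg) (hJ : ‖J - fderiv ℝ (average g) x‖ ≤ eJ)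
    (hy : subproblem f h M u J x y ≤ (⨅ z, subproblem f h M u J x z) + (εbar : EReal)) :
    h y ≠ ⊤ ∧ f (average g y) + (h y).toReal ≤ f (average g x) + (h x).toReal
      - M / 2 * ‖x - proxLinearStep f g h M x‖ ^ 2 - (M / 2 - lf * Lg) * ‖y - x‖ ^ 2 + εbar
      + 2 * (lf * eg) + lf * eJ * (‖y - x‖ + ‖x - proxLinearStep f g h M x‖) := by
  have hh := hA.h_closedConvexProper
  set p := proxLinearStep f g h M x with hp
  obtain ⟨hpt, hgrow⟩ := quadratic_growth hA.f_convex hh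
    (isProxLinearStep_proxLinearStep hM hA hbdd x)
  rw [← hp] at hpt hgrow
  -- Growth around `p`, evaluated at `x`, gains `M ‖p - x‖²`. Comparing `y` with `p` in the inexact
  -- model gives back only half of it.
  have h1 := hgrow x hx
  have h2 : subproblem f h M u J x y ≤
      ((smoothModel f M u J x p + (h p).toReal + εbar : ℝ) : EReal) := by
    refine hy.trans ?_
    rw [EReal.coe_add, ← subproblem_eq hh u J x hpt]
    exact add_le_add (iInf_le _ _) le_rfl
  have hyt := ne_top_of_subproblem_le h2
  rw [subproblem_eq hh u J x hyt, EReal.coe_le_coe_iff] at h2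
  -- The estimation error is paid at both `y` and `p` when passing between the inexact and the exact
  -- model; hence the factor 2 on `eg`.
  have hlin : ∀ z, |f (u + J (z - x)) - f (average g x + fderiv ℝ (average g) x (z - x))| ≤
      lf * (eg + eJ * ‖z - x‖) := fun z => by
    refine (hA.f_lipschitz.norm_sub_le _ _).trans (mul_le_mul_of_nonneg_left ?_ lf.2)
    have e : u + J (z - x) - (average g x + fderiv ℝ (average g) x (z - x)) =
        (u - average g x) + (J - fderiv ℝ (average g) x) (z - x) := by
      simp only [sub_apply]; abel
    rw [e]
    refine (norm_add_le _ _).trans (add_le_add hu ?_)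
    exact ((J - fderiv ℝ (average g) x).le_opNorm _).trans
      (mul_le_mul_of_nonneg_right hJ (norm_nonneg _))
  have h3 := (abs_le.1 (hlin y)).1
  have h4 := (abs_le.1 (hlin p)).2
  have h5 : f (average g y) - f (average g x + fderiv ℝ (average g) x (y - x)) ≤
      lf * (Lg * ‖y - x‖ ^ 2) := by
    refine (le_abs_self _).trans ((hA.f_lipschitz.norm_sub_le _ _).trans
      (mul_le_mul_of_nonneg_left ?_ lf.2))
    rw [← sub_sub]
    exact norm_sub_sub_fderiv_le (differentiable_average hA.g_differentiable) hA.jac_lipschitz x y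
  refine ⟨hyt, ?_⟩
  simp only [smoothModel, sub_self, map_zero, add_zero, norm_zero] at h1 h2
  rw [norm_sub_rev x p] at h1 ⊢
  nlinarith

/-- The decrease over one epoch: `P i` is the length of the exact step, `d i` that of the actual
step, and `ρ i` is the distance to the anchor. -/
theorem epoch_decrease {τ : ℕ} {φ P d ρ : ℕ → ℝ} {e : ℝ} (hM : 0 < M)
    (hρ : ∀ i < τ, 0 ≤ ρ i ∧ ρ i ≤ ∑ l ∈ Finset.range i, d l) (hd : ∀ i, 0 ≤ d i)
    (hstep : ∀ i < τ, φ (i + 1) ≤ φ i - 9 / 20 * M * P i ^ 2 - M / 4 * d i ^ 2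
      + M / 5 * (ρ i / τ) ^ 2 + e) :
    φ τ ≤ φ 0 - 9 / 20 * M * ∑ i ∈ Finset.range τ, P i ^ 2 + τ * e := by
  rcases Nat.eq_zero_or_pos τ with rfl | hτ
  · simp
  have hτ' : (0 : ℝ) < τ := Nat.cast_pos.2 hτ
  set W := ∑ i ∈ Finset.range τ, d i ^ 2 with hW
  -- By Cauchy–Schwarz `ρ i ^ 2 ≤ τ W`. The `τ` terms then sum to at most `W`, and `M/5 ≤ M/4` lets
  -- the step lengths absorb them.
  have h1 : ∀ i < τ, (ρ i / τ) ^ 2 ≤ W / τ := fun i hi => by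
    obtain ⟨ha, hb⟩ := hρ i hi
    have h2 : ∑ l ∈ Finset.range i, d l ≤ ∑ l ∈ Finset.range τ, d l :=
      Finset.sum_le_sum_of_subset_of_nonneg (Finset.range_mono hi.le) fun l _ _ => hd l
    have h3 : (∑ l ∈ Finset.range τ, d l) ^ 2 ≤ τ * W := by
      have := sq_sum_le_card_mul_sum_sq (s := Finset.range τ) (f := d)
      rwa [Finset.card_range] at this
    have h4 : ρ i ^ 2 ≤ τ * W := (pow_le_pow_left₀ ha (hb.trans h2) 2).trans h3
    rw [div_pow, div_le_div_iff₀ (by positivity) hτ']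
    nlinarith
  have h5 : ∑ i ∈ Finset.range τ, (φ (i + 1) - φ i) ≤ ∑ i ∈ Finset.range τ,
      (-(9 / 20 * M * P i ^ 2) - M / 4 * d i ^ 2 + M / 5 * (W / τ) + e) := by
    refine Finset.sum_le_sum fun i hi => ?_
    have hi := Finset.mem_range.1 hi
    have := hstep i hi
    have := mul_le_mul_of_nonneg_left (h1 i hi) (by positivity : 0 ≤ M / 5)
    linarith
  rw [Finset.sum_range_sub] at h5
  simp only [Finset.sum_add_distrib, Finset.sum_sub_distrib, Finset.sum_const, Finset.card_range,
    nsmul_eq_mul, Finset.sum_neg_distrib, ← Finset.mul_sum] at h5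
  rw [← hW] at h5
  have h6 : (τ : ℝ) * (M / 5 * (W / τ)) = M / 5 * W := by field_simp
  have h7 : 0 ≤ W := Finset.sum_nonneg fun i _ => sq_nonneg _
  nlinarith [mul_nonneg hM.le h7]

/-! ### Exact numbers of oracle calls. -/

section Counts

variable {m n N a b : ℕ} {S : Type*} [MeasurableSpace S] (f : Vec m → ℝ)
    (g : Fin N → Vec n → Vec m) (h : Vec n → EReal) (M : ℝ) (solver : Solver n S)
    (εbar δbar : ℝ)

/-- Only the iteration at index `0` makes a full pass; later ones recall the anchor terms from
memory and query the current point alone. -/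
theorem epoch_counts (draw : ℕ → Draw N a b S) (start : Vec n) (i : ℕ) :
    (epoch f g h M solver εbar δbar draw start (i + 1)).evals = N + i * a ∧
    (epoch f g h M solver εbar δbar draw start (i + 1)).jacs = N + i * b := by
  induction i with
  | zero =>
    simp [epoch, estimator, Counted.bind, Counted.pure, Counted.batch, evalOracle, jacOracle]
  | succ i ih =>
    rw [epoch]
    simp only [Counted.bind, ih, estimator, Nat.succ_ne_zero, if_false, Counted.pure, Counted.batch,
      evalOracle, jacOracle]
    constructor <;> simp <;> ring

theorem method_counts (draw : ℕ → ℕ → Draw N a b S) (x₀ : Vec n) {τ : ℕ} (hτ : 0 < τ) (K : ℕ) :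
    (method f g h M solver εbar δbar (fun _ => τ) draw x₀ K).evals = K * (N + (τ - 1) * a) ∧
    (method f g h M solver εbar δbar (fun _ => τ) draw x₀ K).jacs = K * (N + (τ - 1) * b) := by
  induction K with
  | zero => simp [method, Counted.pure]
  | succ K ih =>
    obtain ⟨i, rfl⟩ := Nat.exists_eq_succ_of_ne_zero hτ.ne'
    rw [method]
    simp only [Counted.bind, ih, Nat.succ_eq_add_one, epoch_counts, Counted.pure]
    constructor <;> simp <;> ring

end Counts

theorem one_le_log {x : ℝ} (hx : 8 ≤ x) : 1 ≤ Real.log x := by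
  rw [Real.le_log_iff_exp_le (by linarith)]
  linarith [Real.exp_one_lt_d9]

theorem eight_le_div {d t Δ : ℝ} (hd : 2 ≤ d) (ht : 1 ≤ t) (hΔ : 0 < Δ) (hΔ1 : Δ < 1) :
    8 ≤ 4 * d * t / Δ := by
  rw [le_div_iff₀ hΔ]
  nlinarith

/-! ### Comparison of the call counts with the rates. -/

section Rates

variable {CS Ca Δ ε d : ℝ} {N τ K a p : ℕ}

theorem one_le_ceil_mul (hCS : 0 < CS) (hε : 0 < ε) (hτ : 0 < τ) (hK : K = ⌈CS * ε⁻¹ / τ⌉₊) :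
    1 ≤ (K : ℝ) * τ := by
  have hτ' : (1 : ℝ) ≤ τ := Nat.one_le_cast.2 hτ
  have hK1 : (1 : ℝ) ≤ K := by
    rw [Nat.one_le_cast, hK]
    exact Nat.ceil_pos.2 (by positivity)
  nlinarith

/-- Serves values with `p = 4`, `d = m + 1` and Jacobians with `p = 2`, `d = m + n`. The number of
epochs and the cost of one epoch are bounded below separately, the logarithm being at least 1. -/
theorem le_count (hCS : 0 < CS) (hCa : 0 < Ca) (hN : 0 < N) (hτ : 0 < τ) (hε : 0 < ε)
    (hΔ : 0 < Δ) (hΔ1 : Δ < 1) (hd : 2 ≤ d) (hK : K = ⌈CS * ε⁻¹ / τ⌉₊)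
    (ha : a = ⌈Ca * (τ : ℝ) ^ p * Real.log (4 * d * K * τ / Δ)⌉₊) :
    min 1 CS / 2 * (min 1 Ca / 2) * ((N + (τ : ℝ) ^ (p + 1)) * (1 + ε⁻¹ * (τ : ℝ)⁻¹)) ≤
      ((K * (N + (τ - 1) * a) : ℕ) : ℝ) := by
  have hτ' : (1 : ℝ) ≤ τ := Nat.one_le_cast.2 hτ
  have hN' : (1 : ℝ) ≤ N := Nat.one_le_cast.2 hN
  have hKτ := one_le_ceil_mul hCS hε hτ hK
  have hl : 1 ≤ Real.log (4 * d * K * τ / Δ) := by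
    rw [mul_assoc (4 * d)]
    exact one_le_log (eight_le_div hd hKτ hΔ hΔ1)
  have hq : 0 < ε⁻¹ * (τ : ℝ)⁻¹ := by positivity
  have hK1 : (1 : ℝ) ≤ K := by
    rw [Nat.one_le_cast, hK]
    exact Nat.ceil_pos.2 (by positivity)
  have hK2 : CS * (ε⁻¹ * (τ : ℝ)⁻¹) ≤ K := by
    rw [hK, ← mul_assoc, ← div_eq_mul_inv]
    exact Nat.le_ceil _
  have ha' : Ca * (τ : ℝ) ^ p ≤ a := by
    rw [ha]
    refine le_trans ?_ (Nat.le_ceil _)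
    exact le_mul_of_one_le_right (by positivity) hl
  have h1 : min 1 CS / 2 * (1 + ε⁻¹ * (τ : ℝ)⁻¹) ≤ K := by
    have e1 : min 1 CS ≤ 1 := min_le_left _ _
    have e2 : min 1 CS * (ε⁻¹ * (τ : ℝ)⁻¹) ≤ CS * (ε⁻¹ * (τ : ℝ)⁻¹) :=
      mul_le_mul_of_nonneg_right (min_le_right _ _) hq.le
    linarith
  have h2 : min 1 Ca / 2 * (N + (τ : ℝ) ^ (p + 1)) ≤ N + ((τ - 1 : ℕ) : ℝ) * a := by
    have e1 : min 1 Ca ≤ 1 := min_le_left _ _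
    have e2 : min 1 Ca ≤ Ca := min_le_right _ _
    have e3 : 0 < min 1 Ca := lt_min one_pos hCa
    -- For `τ = 1` no batch is queried, but `N ≥ 1 = τ ^ (p + 1)`; for `τ ≥ 2`, `τ - 1 ≥ τ / 2`.
    rcases (Nat.succ_le_of_lt hτ).eq_or_lt with h | h
    · rw [← h]
      simp only [Nat.succ_eq_add_one, zero_add, Nat.cast_one, one_pow, Nat.sub_self, Nat.cast_zero,
        zero_mul, add_zero]
      nlinarith
    · have h3 : (τ : ℝ) / 2 ≤ ((τ - 1 : ℕ) : ℝ) := by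
        rw [Nat.cast_sub hτ]
        have : (2 : ℝ) ≤ τ := by exact_mod_cast h
        push_cast
        linarith
      have h4 : (τ : ℝ) / 2 * (Ca * (τ : ℝ) ^ p) ≤ ((τ - 1 : ℕ) : ℝ) * a :=
        mul_le_mul h3 ha' (by positivity) (by positivity)
      have h5 : min 1 Ca * (τ : ℝ) ^ (p + 1) ≤ Ca * (τ : ℝ) ^ (p + 1) :=
        mul_le_mul_of_nonneg_right e2 (by positivity)
      have h6 : min 1 Ca * N ≤ 1 * N := mul_le_mul_of_nonneg_right e1 (by positivity)
      rw [pow_succ] at h5 ⊢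
      nlinarith
  push_cast
  calc min 1 CS / 2 * (min 1 Ca / 2) * ((N + (τ : ℝ) ^ (p + 1)) * (1 + ε⁻¹ * (τ : ℝ)⁻¹))
      = (min 1 CS / 2 * (1 + ε⁻¹ * (τ : ℝ)⁻¹)) * (min 1 Ca / 2 * (N + (τ : ℝ) ^ (p + 1))) := by
        ring
    _ ≤ K * (N + ((τ - 1 : ℕ) : ℝ) * a) := by
        refine mul_le_mul h1 h2 ?_ (by positivity)
        have : 0 < min 1 Ca := lt_min one_pos hCa
        positivity

theorem count_le (hCS : 0 < CS) (hCa : 0 < Ca) (hN : 0 < N) (hτ : 0 < τ) (hε : 0 < ε)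
    (hΔ : 0 < Δ) (hΔ1 : Δ < 1) (hd : 2 ≤ d) (hK : K = ⌈CS * ε⁻¹ / τ⌉₊)
    (ha : a = ⌈Ca * (τ : ℝ) ^ p * Real.log (4 * d * K * τ / Δ)⌉₊) :
    ((K * (N + (τ - 1) * a) : ℕ) : ℝ) ≤ (CS + 1) * (Ca + 1) * (Real.log (CS + 1) + 1) *
      ((N + (τ : ℝ) ^ (p + 1)) * (1 + ε⁻¹ * (τ : ℝ)⁻¹)) *
      Real.log (4 * d * (τ + ε⁻¹) / Δ) := by
  have hτ' : (1 : ℝ) ≤ τ := Nat.one_le_cast.2 hτ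
  have hε' : 0 < ε⁻¹ := inv_pos.2 hε
  have hKτ := one_le_ceil_mul hCS hε hτ hK
  set l := Real.log (4 * d * K * τ / Δ) with hl_def
  set l' := Real.log (4 * d * (τ + ε⁻¹) / Δ) with hl'_def
  have hl : 1 ≤ l := by
    rw [hl_def, mul_assoc (4 * d)]
    exact one_le_log (eight_le_div hd hKτ hΔ hΔ1)
  have hl' : 1 ≤ l' := one_le_log (eight_le_div hd (by linarith) hΔ hΔ1)
  have hq : 0 < ε⁻¹ * (τ : ℝ)⁻¹ := by positivity
  have hK2 : (K : ℝ) ≤ CS * (ε⁻¹ * (τ : ℝ)⁻¹) + 1 := by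
    rw [hK, ← mul_assoc, ← div_eq_mul_inv]
    exact (Nat.ceil_lt_add_one (by positivity)).le
  have hK3 : (K : ℝ) ≤ (CS + 1) * (1 + ε⁻¹ * (τ : ℝ)⁻¹) := by nlinarith
  have hKτ' : (K : ℝ) * τ ≤ (CS + 1) * (τ + ε⁻¹) := by
    have := mul_le_mul_of_nonneg_right hK2 (by positivity : (0 : ℝ) ≤ τ)
    have e : (CS * (ε⁻¹ * (τ : ℝ)⁻¹) + 1) * τ = CS * ε⁻¹ + τ := by field_simp
    nlinarith
  -- From `K τ ≤ (CS + 1)(τ + ε⁻¹)`; the additive `log (CS + 1)` becomes a factor because `l' ≥ 1`.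
  have hll : l ≤ (Real.log (CS + 1) + 1) * l' := by
    have h1 : l ≤ Real.log ((CS + 1) * (4 * d * (τ + ε⁻¹) / Δ)) := by
      refine Real.log_le_log ?_ ?_
      · rw [mul_assoc (4 * d)]; positivity
      · have e : (CS + 1) * (4 * d * (τ + ε⁻¹) / Δ) = 4 * d * ((CS + 1) * (τ + ε⁻¹)) / Δ := by ring
        rw [e, mul_assoc (4 * d)]
        exact div_le_div_of_nonneg_right (mul_le_mul_of_nonneg_left hKτ' (by positivity)) hΔ.le
    rw [Real.log_mul (by positivity) (by positivity)] at h1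
    have h2 : 0 ≤ Real.log (CS + 1) := Real.log_nonneg (by linarith)
    nlinarith
  have ha' : (a : ℝ) ≤ Ca * (τ : ℝ) ^ p * l + 1 := by
    rw [ha]
    exact (Nat.ceil_lt_add_one (by positivity)).le
  have hp : (1 : ℝ) ≤ (τ : ℝ) ^ p := one_le_pow₀ hτ'
  have h2 : N + ((τ - 1 : ℕ) : ℝ) * a ≤ (Ca + 1) * (N + (τ : ℝ) ^ (p + 1)) * l := by
    have h3 : ((τ - 1 : ℕ) : ℝ) ≤ τ := Nat.cast_le.2 (Nat.sub_le _ _)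
    have h4 : ((τ - 1 : ℕ) : ℝ) * a ≤ τ * (Ca * (τ : ℝ) ^ p * l + 1) :=
      mul_le_mul h3 ha' (by positivity) (by positivity)
    have h5 : (τ : ℝ) * 1 ≤ τ * (τ : ℝ) ^ p * l := by
      rw [mul_assoc]
      exact mul_le_mul_of_nonneg_left (by nlinarith) (by positivity)
    have h6 : (N : ℝ) ≤ N * l := le_mul_of_one_le_right (by positivity) hl
    have h7 : 0 ≤ Ca * N * l := by positivity
    rw [pow_succ]
    nlinarith
  push_cast
  have h3 : 0 ≤ (Ca + 1) * (N + (τ : ℝ) ^ (p + 1)) := by positivity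
  calc (K : ℝ) * (N + ((τ - 1 : ℕ) : ℝ) * a)
      ≤ ((CS + 1) * (1 + ε⁻¹ * (τ : ℝ)⁻¹)) * ((Ca + 1) * (N + (τ : ℝ) ^ (p + 1)) * l) :=
        mul_le_mul hK3 h2 (by positivity) (by positivity)
    _ ≤ ((CS + 1) * (1 + ε⁻¹ * (τ : ℝ)⁻¹)) * ((Ca + 1) * (N + (τ : ℝ) ^ (p + 1)) *
          ((Real.log (CS + 1) + 1) * l')) := by
        refine mul_le_mul_of_nonneg_left (mul_le_mul_of_nonneg_left hll h3) (by positivity)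
    _ = _ := by ring

/-- The argument of the logarithm is at most `8 ε⁻²`, and `8 ≤ ε⁻³` because `ε ≤ 1/2`; hence the
factor 5. -/
theorem log_le_of_small (hτ : 0 < τ) (hε : 0 < ε) (hΔ : 0 < Δ) (hd : 2 ≤ d)
    (h1 : ε ≤ 1 / 2) (h2 : ε ≤ 1 / τ) (h3 : ε ≤ Δ / d) :
    Real.log (4 * d * (τ + ε⁻¹) / Δ) ≤ 5 * Real.log ε⁻¹ := by
  have hτ' : (0 : ℝ) < τ := Nat.cast_pos.2 hτ
  have e1 : 2 ≤ ε⁻¹ := by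
    rw [le_inv_comm₀ two_pos hε]; linarith
  have e2 : (τ : ℝ) ≤ ε⁻¹ := by
    rw [le_inv_comm₀ hτ' hε]; rwa [one_div] at h2
  have e3 : d / Δ ≤ ε⁻¹ := by
    rw [le_inv_comm₀ (by positivity) hε, inv_div]; exact h3
  rw [← Real.log_rpow (by positivity)]
  refine Real.log_le_log (by positivity) ?_
  have e4 : 4 * d * (τ + ε⁻¹) / Δ = 4 * (d / Δ) * (τ + ε⁻¹) := by ring
  rw [e4, show (5 : ℝ) = ((5 : ℕ) : ℝ) by norm_num, Real.rpow_natCast]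
  have e5 : 0 < d / Δ := by positivity
  calc 4 * (d / Δ) * (τ + ε⁻¹) ≤ 4 * ε⁻¹ * (ε⁻¹ + ε⁻¹) := by gcongr
    _ = 2 ^ 3 * ε⁻¹ ^ 2 := by ring
    _ ≤ ε⁻¹ ^ 3 * ε⁻¹ ^ 2 := by gcongr
    _ = ε⁻¹ ^ 5 := by ring

/-- The rate is the cost of an epoch times the number of epochs, up to constants and logarithms. -/
theorem evalRate_eq (N : ℕ) (hτ : 0 < τ) :
    evalRate N τ ε = (N + (τ : ℝ) ^ (4 + 1)) * (1 + ε⁻¹ * (τ : ℝ)⁻¹) := by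
  have hτ' : (0 : ℝ) < τ := Nat.cast_pos.2 hτ
  rw [evalRate]
  field_simp
  ring

theorem jacRate_eq (N : ℕ) (hτ : 0 < τ) :
    jacRate N τ ε = (N + (τ : ℝ) ^ (2 + 1)) * (1 + ε⁻¹ * (τ : ℝ)⁻¹) := by
  have hτ' : (0 : ℝ) < τ := Nat.cast_pos.2 hτ
  rw [jacRate]
  field_simp
  ring

end Rates

/-! ### The estimators as functions of anchor, iterate and batch, and their accuracy. -/

section Estimates

variable {m n N a b : ℕ}

/-- The first-order remainder of the component `g j` between the anchor `z.1` and `z.2`. -/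
noncomputable def remainder (g : Fin N → Vec n → Vec m) (z : Vec n × Vec n) (j : Fin N) : Vec m :=
  g j z.2 - g j z.1 - fderiv ℝ (g j) z.1 (z.2 - z.1)

/-- The variation of the Jacobian of `g j` between the anchor `z.1` and `z.2`. -/
noncomputable def jacVariation (g : Fin N → Vec n → Vec m) (z : Vec n × Vec n) (j : Fin N) :
    Jac n m :=
  fderiv ℝ (g j) z.2 - fderiv ℝ (g j) z.1

/-- The average of the component Jacobians. -/
noncomputable def averageJac (g : Fin N → Vec n → Vec m) (x : Vec n) : Jac n m :=
  (N : ℝ)⁻¹ • ∑ j, fderiv ℝ (g j) x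

/-- The estimate of the value of the average at the `i`-th inner iteration, as a function of the
anchor, the current iterate and the batch. -/
noncomputable def valueEstimate (g : Fin N → Vec n → Vec m) (i : ℕ) (z : Vec n × Vec n)
    (A : Fin a → Fin N) : Vec m :=
  if i = 0 then average g z.2 else
    (a : ℝ)⁻¹ • ∑ r, remainder g z (A r) + average g z.1 + averageJac g z.1 (z.2 - z.1)

/-- The estimate of the Jacobian of the average at the `i`-th inner iteration. -/
noncomputable def jacEstimate (g : Fin N → Vec n → Vec m) (i : ℕ) (z : Vec n × Vec n)
    (B : Fin b → Fin N) : Jac n m :=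
  if i = 0 then averageJac g z.2 else (b : ℝ)⁻¹ • ∑ r, jacVariation g z (B r) + averageJac g z.1

variable {S : Type*} [MeasurableSpace S] (f : Vec m → ℝ)
    (g : Fin N → Vec n → Vec m) (h : Vec n → EReal) (M : ℝ) (solver : Solver n S)
    (εbar δbar : ℝ)

/-- The data of the subproblem solved at the `i`-th inner iteration. -/
noncomputable def modelData (i : ℕ) (z : Vec n × Vec n) (d : Draw N a b S) :
    Vec m × Jac n m × Vec n :=
  (valueEstimate g i z d.1, jacEstimate g i z d.2.1, z.2)

/-- The output of the solver on the model with data `p`, for the seed `ξ`. -/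
noncomputable def solverOutput (p : Vec m × Jac n m × Vec n) (ξ : S) : Vec n :=
  solver.run (subproblem f h M p.1 p.2.1 p.2.2) εbar δbar ξ

/-- The next iterate as a function of the anchor, the current iterate and the random input. -/
noncomputable def nextIterate (i : ℕ) (z : Vec n × Vec n) (d : Draw N a b S) : Vec n :=
  solverOutput f h M solver εbar δbar (modelData g i z d) d.2.2

/-- The memory is fixed by the anchor from the first iteration on. A step thus depends only on the
anchor, the current iterate and the fresh draw, which is the Markov structure needed for
conditioning. -/
theorem epoch_succ_val (draw : ℕ → Draw N a b S) (start : Vec n) (i : ℕ) :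
    (epoch f g h M solver εbar δbar draw start (i + 1)).val =
      (nextIterate f g h M solver εbar δbar i
        (start, (epoch f g h M solver εbar δbar draw start i).val.1) (draw i),
        ⟨start, fun j => g j start, fun j => fderiv ℝ (g j) start⟩) := by
  induction i with
  | zero => rfl
  | succ i ih =>
    rw [epoch]
    simp only [Counted.bind, ih, Counted.pure, estimator, Nat.succ_ne_zero, if_false,
      Counted.batch, evalOracle, jacOracle, nextIterate, solverOutput, modelData, valueEstimate, jacEstimate]
    rfl

theorem iterate_succ (τ : ℕ → ℕ) (draw : ℕ → ℕ → Draw N a b S) (x₀ : Vec n) (k i : ℕ) :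
    iterate f g h M solver εbar δbar τ draw x₀ k (i + 1) =
      nextIterate f g h M solver εbar δbar i (iterate f g h M solver εbar δbar τ draw x₀ k 0,
        iterate f g h M solver εbar δbar τ draw x₀ k i) (draw k i) := by
  rw [iterate, epoch_succ_val]; rfl

theorem iterate_zero_zero (τ : ℕ → ℕ) (draw : ℕ → ℕ → Draw N a b S) (x₀ : Vec n) :
    iterate f g h M solver εbar δbar τ draw x₀ 0 0 = x₀ := rfl

theorem iterate_succ_zero (τ : ℕ → ℕ) (draw : ℕ → ℕ → Draw N a b S) (x₀ : Vec n) (k : ℕ) :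
    iterate f g h M solver εbar δbar τ draw x₀ (k + 1) 0 =
      iterate f g h M solver εbar δbar τ draw x₀ k (τ k) := rfl

/-! ### Accuracy of the estimates -/

theorem sum_sub_mean_eq_zero {V : Type*} [NormedAddCommGroup V] [NormedSpace ℝ V] [NeZero N]
    (v : Fin N → V) : ∑ j, (v j - (N : ℝ)⁻¹ • ∑ l, v l) = 0 := by
  have : (N : ℝ) ≠ 0 := Nat.cast_ne_zero.2 (NeZero.ne N)
  rw [Finset.sum_sub_distrib, Finset.sum_const, Finset.card_univ, Fintype.card_fin,
    ← Nat.cast_smul_eq_nsmul ℝ, smul_smul, mul_inv_cancel₀ this, one_smul, sub_self]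

theorem norm_sub_mean_le {V : Type*} [NormedAddCommGroup V] [NormedSpace ℝ V] [NeZero N]
    {v : Fin N → V} {B : ℝ} (hv : ∀ j, ‖v j‖ ≤ B) (j : Fin N) :
    ‖v j - (N : ℝ)⁻¹ • ∑ l, v l‖ ≤ 2 * B := by
  have hN : (0 : ℝ) < N := Nat.cast_pos.2 (NeZero.pos N)
  have h1 : ‖(N : ℝ)⁻¹ • ∑ l, v l‖ ≤ B := by
    rw [norm_smul, Real.norm_of_nonneg (by positivity), ← div_eq_inv_mul, div_le_iff₀ hN]
    refine (norm_sum_le _ _).trans ((Finset.sum_le_sum fun l _ => hv l).trans ?_)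
    simp [mul_comm]
  linarith [norm_sub_le (v j) ((N : ℝ)⁻¹ • ∑ l, v l), hv j]

theorem mean_sub_mean {V : Type*} [NormedAddCommGroup V] [NormedSpace ℝ V] {s : ℕ} (hs : 0 < s)
    (v : Fin N → V) (A : Fin s → Fin N) :
    (s : ℝ)⁻¹ • ∑ r, (v (A r) - (N : ℝ)⁻¹ • ∑ l, v l) =
      (s : ℝ)⁻¹ • ∑ r, v (A r) - (N : ℝ)⁻¹ • ∑ l, v l := by
  have : (s : ℝ) ≠ 0 := Nat.cast_ne_zero.2 hs.ne'
  rw [Finset.sum_sub_distrib, smul_sub, Finset.sum_const, Finset.card_univ, Fintype.card_fin,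
    ← Nat.cast_smul_eq_nsmul ℝ, smul_smul, inv_mul_cancel₀ this, one_smul]

variable {f g h M}

/-- The first-order expansion at the anchor cancels in the mean, so only centered second-order
remainders are left to concentrate. -/
theorem valueEstimate_sub {i : ℕ} (hi : i ≠ 0) (ha : 0 < a)
    (z : Vec n × Vec n) (A : Fin a → Fin N) :
    valueEstimate g i z A - average g z.2 =
      (a : ℝ)⁻¹ • ∑ r, (remainder g z (A r) - (N : ℝ)⁻¹ • ∑ l, remainder g z l) := by
  have h1 : (N : ℝ)⁻¹ • ∑ l, remainder g z l =
      average g z.2 - average g z.1 - averageJac g z.1 (z.2 - z.1) := by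
    simp only [remainder, average, averageJac, Finset.sum_sub_distrib, smul_sub,
      smul_apply, sum_apply]
  rw [mean_sub_mean ha, h1, valueEstimate, if_neg hi]
  abel

theorem jacEstimate_sub {i : ℕ} (hi : i ≠ 0) (hb : 0 < b)
    (z : Vec n × Vec n) (B : Fin b → Fin N) :
    jacEstimate g i z B - averageJac g z.2 =
      (b : ℝ)⁻¹ • ∑ r, (jacVariation g z (B r) - (N : ℝ)⁻¹ • ∑ l, jacVariation g z l) := by
  have h1 : (N : ℝ)⁻¹ • ∑ l, jacVariation g z l = averageJac g z.2 - averageJac g z.1 := by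
    simp only [jacVariation, averageJac, Finset.sum_sub_distrib, smul_sub]
  rw [mean_sub_mean hb, h1, jacEstimate, if_neg hi]
  abel

/-- The batch size makes the Hoeffding bound a fixed fraction of `M`. -/
theorem sqrt_bound {w q T l C : ℝ} {s : ℕ} (hM : 0 < M) (hq : 0 < q) (hT : 0 < T)
    (hl : 0 < l) (hC : 24 * q ^ 2 * (w / M) ^ 2 + 1 ≤ C) (hs : C * T ^ 2 * l ≤ s) :
    w * (√(6 * l / s) * 2) ≤ M / (q * T) := by
  have hC0 : 0 < C := lt_of_lt_of_le (by positivity) hC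
  have hs0 : (0 : ℝ) < s := lt_of_lt_of_le (by positivity) hs
  refine le_of_sq_le_sq ?_ (by positivity)
  -- The constant is `24 = 6 · 2²`: 6 from the Hoeffding bound, 2 from centering the summands.
  have h1 : (w * (√(6 * l / s) * 2)) ^ 2 = 24 * w ^ 2 * l / s := by
    rw [mul_pow, mul_pow, Real.sq_sqrt (by positivity)]; ring
  rw [h1, div_pow, div_le_div_iff₀ hs0 (by positivity)]
  have h2 : 24 * q ^ 2 * w ^ 2 ≤ C * M ^ 2 := by
    have h3 : 24 * q ^ 2 * (w / M) ^ 2 ≤ C := by linarith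
    rw [div_pow, ← mul_div_assoc, div_le_iff₀ (by positivity)] at h3
    exact h3
  calc 24 * w ^ 2 * l * (q * T) ^ 2 = 24 * q ^ 2 * w ^ 2 * (T ^ 2 * l) := by ring
    _ ≤ C * M ^ 2 * (T ^ 2 * l) := mul_le_mul_of_nonneg_right h2 (by positivity)
    _ = M ^ 2 * (C * T ^ 2 * l) := by ring
    _ ≤ M ^ 2 * s := mul_le_mul_of_nonneg_left hs (by positivity)

variable {lf Lhat : ℝ≥0}

/-- Remainders are quadratic in the distance `ρ` to the anchor, so the deviation is of order `ρ²
√(log / a)`; a batch of order `τ⁴ log` brings it to `(ρ/τ)²`. -/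
theorem batchLaw_valueEstimate_bad_le [NeZero N] (hM : 0 < M)
    (hg : ∀ j, Differentiable ℝ (g j)) (hL : UniformLipschitz g Lhat) {τ : ℕ} (hτ : 0 < τ)
    {δ : ℝ} (hδ : 0 < δ) (hl : 1 ≤ Real.log ((m + 1) / δ)) {C : ℝ}
    (hC : 24 * 20 ^ 2 * ((lf * Lhat : ℝ) / M) ^ 2 + 1 ≤ C)
    (ha : C * (τ : ℝ) ^ 4 * Real.log ((m + 1) / δ) ≤ a) (i : ℕ) (z : Vec n × Vec n) :
    batchLaw N a {A | ¬ lf * ‖valueEstimate g i z A - average g z.2‖ ≤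
      M / 20 * (‖z.2 - z.1‖ / τ) ^ 2} ≤ ENNReal.ofReal δ := by
  have hτ' : (0 : ℝ) < τ := Nat.cast_pos.2 hτ
  -- At the anchor the estimate is exact, so failure is impossible.
  rcases eq_or_ne i 0 with rfl | hi
  · have : {A : Fin a → Fin N | ¬ lf * ‖valueEstimate g 0 z A - average g z.2‖ ≤
      M / 20 * (‖z.2 - z.1‖ / τ) ^ 2} = ∅ := by
      ext A
      simp only [valueEstimate, if_true, sub_self, norm_zero, mul_zero, Set.mem_ofPred_eq,
        Set.mem_empty_iff_false, iff_false, not_not]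
      positivity
    rw [this, measure_empty]
    exact zero_le
  have hC0 : 0 < C := lt_of_lt_of_le (by positivity) hC
  have ha0 : 0 < a := by
    have : (0 : ℝ) < a := lt_of_lt_of_le (by positivity) ha
    exact_mod_cast this
  have hrem : ∀ j, ‖remainder g z j‖ ≤ Lhat * ‖z.2 - z.1‖ ^ 2 := fun j =>
    norm_sub_sub_fderiv_le (hg j) (hL.jac_lipschitz j) z.1 z.2
  refine (measure_mono fun A hA => ?_).trans (batchLaw_norm_mean_vec_gt_le ha0
    (fun j => norm_sub_mean_le hrem j) (sum_sub_mean_eq_zero _) hδ hl)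
  rw [Set.mem_ofPred_eq] at hA ⊢
  rw [valueEstimate_sub hi ha0] at hA
  by_contra! hc
  refine hA ((mul_le_mul_of_nonneg_left hc lf.2).trans ?_)
  have h1 := sqrt_bound (w := lf * Lhat) (q := 20) (T := (τ : ℝ) ^ 2) hM
    (by norm_num) (by positivity) (lt_of_lt_of_le one_pos hl) hC (by rwa [← pow_mul])
  have h2 := mul_le_mul_of_nonneg_right h1 (sq_nonneg ‖z.2 - z.1‖)
  calc (lf : ℝ) * (√(6 * Real.log ((m + 1) / δ) / a) * (2 * (Lhat * ‖z.2 - z.1‖ ^ 2)))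
      = lf * Lhat * (√(6 * Real.log ((m + 1) / δ) / a) * 2) * ‖z.2 - z.1‖ ^ 2 := by ring
    _ ≤ M / (20 * (τ : ℝ) ^ 2) * ‖z.2 - z.1‖ ^ 2 := h2
    _ = M / 20 * (‖z.2 - z.1‖ / τ) ^ 2 := by rw [div_pow]; field_simp

/-- Jacobian variations are only linear in the distance to the anchor, so a batch of order `τ² log`
suffices. -/
theorem batchLaw_jacEstimate_bad_le [NeZero N] (hM : 0 < M)
    (hL : UniformLipschitz g Lhat) {τ : ℕ} (hτ : 0 < τ)
    {δ : ℝ} (hδ : 0 < δ) (hl : 1 ≤ Real.log ((m + n) / δ)) {C : ℝ}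
    (hC : 24 * 10 ^ 2 * ((lf * Lhat : ℝ) / M) ^ 2 + 1 ≤ C)
    (hb : C * (τ : ℝ) ^ 2 * Real.log ((m + n) / δ) ≤ b) (i : ℕ) (z : Vec n × Vec n) :
    batchLaw N b {B | ¬ lf * ‖jacEstimate g i z B - averageJac g z.2‖ ≤
      M / 10 * (‖z.2 - z.1‖ / τ)} ≤ ENNReal.ofReal δ := by
  have hτ' : (0 : ℝ) < τ := Nat.cast_pos.2 hτ
  rcases eq_or_ne i 0 with rfl | hi
  · have : {B : Fin b → Fin N | ¬ lf * ‖jacEstimate g 0 z B - averageJac g z.2‖ ≤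
      M / 10 * (‖z.2 - z.1‖ / τ)} = ∅ := by
      ext A
      simp only [jacEstimate, if_true, sub_self, norm_zero, mul_zero, Set.mem_ofPred_eq,
        Set.mem_empty_iff_false, iff_false, not_not]
      positivity
    rw [this, measure_empty]
    exact zero_le
  have hC0 : 0 < C := lt_of_lt_of_le (by positivity) hC
  have hb0 : 0 < b := by
    have : (0 : ℝ) < b := lt_of_lt_of_le (by positivity) hb
    exact_mod_cast this
  have hvar : ∀ j, ‖jacVariation g z j‖ ≤ Lhat * ‖z.2 - z.1‖ := fun j =>
    (hL.jac_lipschitz j).norm_sub_le z.2 z.1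
  refine (measure_mono fun B hB => ?_).trans (batchLaw_norm_mean_gt_le hb0
    (fun j => norm_sub_mean_le hvar j) (sum_sub_mean_eq_zero _) hδ hl)
  rw [Set.mem_ofPred_eq] at hB ⊢
  rw [jacEstimate_sub hi hb0] at hB
  by_contra! hc
  refine hB ((mul_le_mul_of_nonneg_left hc lf.2).trans ?_)
  have h1 := sqrt_bound (w := lf * Lhat) (q := 10) (T := (τ : ℝ)) hM
    (by norm_num) (by positivity) (lt_of_lt_of_le one_pos hl) hC hb
  have h2 := mul_le_mul_of_nonneg_right h1 (norm_nonneg (z.2 - z.1))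
  calc (lf : ℝ) * (√(6 * Real.log ((m + n) / δ) / b) * (2 * (Lhat * ‖z.2 - z.1‖)))
      = lf * Lhat * (√(6 * Real.log ((m + n) / δ) / b) * 2) * ‖z.2 - z.1‖ := by ring
    _ ≤ M / (10 * (τ : ℝ)) * ‖z.2 - z.1‖ := h2
    _ = M / 10 * (‖z.2 - z.1‖ / τ) := by field_simp

end Estimates

/-! ### Joint measurability of estimates, solver output and good events. -/

section Measurability

variable {m n N a b : ℕ} {f : Vec m → ℝ} {g : Fin N → Vec n → Vec m} {h : Vec n → EReal}
  {lf Lg Lhat : ℝ≥0} {M : ℝ}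

theorem measurable_sum_batch {Z V : Type*} [MeasurableSpace Z] [NormedAddCommGroup V]
    [MeasurableSpace V] [BorelSpace V] [SecondCountableTopology V] {s : ℕ} {F : Z → Fin N → V}
    (hF : ∀ j, Measurable fun z => F z j) :
    Measurable fun p : Z × (Fin s → Fin N) => ∑ r, F p.1 (p.2 r) := by
  refine Finset.measurable_fun_sum _ fun r _ => ?_
  have h1 : Measurable fun p : Z × Fin N => F p.1 p.2 := measurable_from_prod_countable_left hF
  exact h1.comp (measurable_fst.prodMk ((measurable_pi_apply r).comp measurable_snd))

theorem continuous_average (hg : ∀ j, Differentiable ℝ (g j)) : Continuous (average g) :=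
  (differentiable_average hg).continuous

theorem continuous_averageJac (hL : UniformLipschitz g Lhat) : Continuous (averageJac g) := by
  unfold averageJac
  exact (continuous_finsetSum _ fun j _ => (hL.jac_lipschitz j).continuous).const_smul (N : ℝ)⁻¹

theorem measurable_valueEstimate (hg : ∀ j, Differentiable ℝ (g j)) (hL : UniformLipschitz g Lhat)
    (i : ℕ) : Measurable fun p : (Vec n × Vec n) × (Fin a → Fin N) =>
      valueEstimate g i p.1 p.2 := by
  rcases eq_or_ne i 0 with rfl | hi
  · simp only [valueEstimate, if_true]
    exact (continuous_average hg).measurable.comp (measurable_snd.comp measurable_fst)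
  · simp only [valueEstimate, if_neg hi]
    have h1 : Measurable fun p : (Vec n × Vec n) × (Fin a → Fin N) =>
        ∑ r, remainder g p.1 (p.2 r) := by
      refine measurable_sum_batch (F := remainder g) fun j => Continuous.measurable ?_
      have := (hg j).continuous
      have := (hL.jac_lipschitz j).continuous
      unfold remainder
      fun_prop
    have h2 : Measurable fun z : Vec n × Vec n =>
        average g z.1 + averageJac g z.1 (z.2 - z.1) := by
      refine Continuous.measurable ?_
      have := continuous_average hg
      have := continuous_averageJac hL
      fun_prop
    simp only [add_assoc]
    exact (h1.const_smul (a : ℝ)⁻¹).add (h2.comp measurable_fst)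

theorem measurable_jacEstimate (hL : UniformLipschitz g Lhat) (i : ℕ) :
    Measurable fun p : (Vec n × Vec n) × (Fin b → Fin N) => jacEstimate g i p.1 p.2 := by
  rcases eq_or_ne i 0 with rfl | hi
  · simp only [jacEstimate, if_true]
    exact (continuous_averageJac hL).measurable.comp (measurable_snd.comp measurable_fst)
  · simp only [jacEstimate, if_neg hi]
    have h1 : Measurable fun p : (Vec n × Vec n) × (Fin b → Fin N) =>
        ∑ r, jacVariation g p.1 (p.2 r) := by
      refine measurable_sum_batch (F := jacVariation g) fun j => Continuous.measurable ?_
      have := (hL.jac_lipschitz j).continuous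
      unfold jacVariation
      fun_prop
    exact (h1.const_smul (b : ℝ)⁻¹).add
      ((continuous_averageJac hL).measurable.comp (measurable_fst.comp measurable_fst))

theorem measurable_subproblem (hf : Continuous f) (hh : IsClosedConvexProper h) :
    Measurable fun p : (Vec m × Jac n m × Vec n) × Vec n =>
      subproblem f h M p.1.1 p.1.2.1 p.1.2.2 p.2 := by
  unfold subproblem
  refine Measurable.add ?_ (hh.closed.measurable.comp measurable_snd)
  refine Continuous.measurable (continuous_coe_real_ereal.comp ?_)
  fun_prop

/-- The infimum is uncountable, but for fixed `y` the model is continuous in its data, so the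
infimum is upper semicontinuous. -/
theorem measurable_iInf_subproblem (hf : Continuous f) :
    Measurable fun p : Vec m × Jac n m × Vec n => ⨅ y, subproblem f h M p.1 p.2.1 p.2.2 y := by
  refine UpperSemicontinuous.measurable (upperSemicontinuous_iInf fun y => ?_)
  unfold subproblem
  refine UpperSemicontinuous.add' (Continuous.upperSemicontinuous ?_)
    upperSemicontinuous_const fun p => ?_
  · refine continuous_coe_real_ereal.comp ?_
    fun_prop
  · exact EReal.continuousAt_add (Or.inl (EReal.coe_ne_top _)) (Or.inl (EReal.coe_ne_bot _))

variable {S : Type*} [MeasurableSpace S] {solver : Solver n S} {εbar δbar : ℝ}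

/-- The solver call with data `p` and seed `ξ` reaches the accuracy `εbar`. -/
def IsAccurate (f : Vec m → ℝ) (h : Vec n → EReal) (M : ℝ) (solver : Solver n S) (εbar δbar : ℝ)
    (p : Vec m × Jac n m × Vec n) (ξ : S) : Prop :=
  subproblem f h M p.1 p.2.1 p.2.2 (solverOutput f h M solver εbar δbar p ξ) ≤
    (⨅ y, subproblem f h M p.1 p.2.1 p.2.2 y) + (εbar : EReal)

theorem measurable_solverOutput (hs : SolverAssumption f h M solver) (hε : 0 < εbar)
    (hδ : 0 < δbar) : Measurable fun q : (Vec m × Jac n m × Vec n) × S =>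
      solverOutput f h M solver εbar δbar q.1 q.2 :=
  hs.measurable εbar δbar hε hδ

theorem measurableSet_isAccurate (hf : Continuous f) (hh : IsClosedConvexProper h)
    (hs : SolverAssumption f h M solver) (hε : 0 < εbar) (hδ : 0 < δbar) :
    MeasurableSet {q : (Vec m × Jac n m × Vec n) × S |
      IsAccurate f h M solver εbar δbar q.1 q.2} := by
  have h1 : Measurable fun q : (Vec m × Jac n m × Vec n) × S =>
      subproblem f h M q.1.1 q.1.2.1 q.1.2.2 (solverOutput f h M solver εbar δbar q.1 q.2) := by
    have e1 : Measurable fun q : (Vec m × Jac n m × Vec n) × S => q.1 := measurable_fst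
    have e2 := e1.prodMk (measurable_solverOutput hs hε hδ)
    have e3 := (measurable_subproblem (M := M) (n := n) hf hh).comp e2
    exact e3
  have h2 : Measurable fun q : (Vec m × Jac n m × Vec n) × S =>
      (⨅ y, subproblem f h M q.1.1 q.1.2.1 q.1.2.2 y) + (εbar : EReal) := by
    have e1 : Measurable fun q : (Vec m × Jac n m × Vec n) × S => q.1 := measurable_fst
    have e2 := (measurable_iInf_subproblem (h := h) (M := M) (n := n) hf).comp e1
    exact e2.add measurable_const
  exact measurableSet_le h1 h2

theorem law_not_isAccurate_le (hf : Continuous f) (hh : IsClosedConvexProper h)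
    (hs : SolverAssumption f h M solver) (hε : 0 < εbar) (hδ : 0 < δbar)
    (p : Vec m × Jac n m × Vec n) :
    solver.law {ξ | ¬ IsAccurate f h M solver εbar δbar p ξ} ≤ ENNReal.ofReal δbar := by
  have := hs.isProbabilityMeasure
  have hmeas : MeasurableSet {ξ | IsAccurate f h M solver εbar δbar p ξ} :=
    measurable_prodMk_left (measurableSet_isAccurate hf hh hs hε hδ)
  have h1 : ENNReal.ofReal (1 - δbar) ≤
      solver.law {ξ | IsAccurate f h M solver εbar δbar p ξ} :=
    hs.accurate εbar δbar hε hδ p.1 p.2.1 p.2.2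
  change solver.law {ξ | IsAccurate f h M solver εbar δbar p ξ}ᶜ ≤ _
  rw [prob_compl_eq_one_sub hmeas]
  refine (tsub_le_tsub_left h1 1).trans ?_
  rw [tsub_le_iff_right, ← ENNReal.ofReal_one]
  refine le_trans ?_ ENNReal.ofReal_add_le
  exact ENNReal.ofReal_le_ofReal (by linarith)

/-- The event that the estimates of one inner iteration are precise and the solver is accurate. -/
def IsGoodDraw (f : Vec m → ℝ) (g : Fin N → Vec n → Vec m) (h : Vec n → EReal) (M : ℝ) (lf : ℝ≥0)
    (solver : Solver n S) (εbar δbar : ℝ) (τ i : ℕ) (z : Vec n × Vec n) (d : Draw N a b S) :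
    Prop :=
  lf * ‖valueEstimate g i z d.1 - average g z.2‖ ≤ M / 20 * (‖z.2 - z.1‖ / τ) ^ 2 ∧
  lf * ‖jacEstimate g i z d.2.1 - averageJac g z.2‖ ≤ M / 10 * (‖z.2 - z.1‖ / τ) ∧
  IsAccurate f h M solver εbar δbar (modelData g i z d) d.2.2

theorem measurable_modelData (hg : ∀ j, Differentiable ℝ (g j)) (hL : UniformLipschitz g Lhat)
    (i : ℕ) : Measurable fun p : (Vec n × Vec n) × Draw N a b S => modelData g i p.1 p.2 := by
  have hA : Measurable fun p : (Vec n × Vec n) × Draw N a b S => p.2.1 :=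
    measurable_fst.comp measurable_snd
  have hB : Measurable fun p : (Vec n × Vec n) × Draw N a b S => p.2.2.1 :=
    measurable_fst.comp (measurable_snd.comp measurable_snd)
  have hz : Measurable fun p : (Vec n × Vec n) × Draw N a b S => p.1 := measurable_fst
  have h1 := (measurable_valueEstimate (a := a) hg hL i).comp (hz.prodMk hA)
  have h2 := (measurable_jacEstimate (b := b) hL i).comp (hz.prodMk hB)
  have h3 : Measurable fun p : (Vec n × Vec n) × Draw N a b S => p.1.2 :=
    measurable_snd.comp measurable_fst
  exact h1.prodMk (h2.prodMk h3)

theorem measurable_nextIterate (hs : SolverAssumption f h M solver)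
    (hg : ∀ j, Differentiable ℝ (g j)) (hL : UniformLipschitz g Lhat)
    (hε : 0 < εbar) (hδ : 0 < δbar) (i : ℕ) :
    Measurable fun p : (Vec n × Vec n) × Draw N a b S =>
      nextIterate f g h M solver εbar δbar i p.1 p.2 := by
  have h1 : Measurable fun p : (Vec n × Vec n) × Draw N a b S => p.2.2.2 :=
    measurable_snd.comp (measurable_snd.comp measurable_snd)
  have h2 := (measurable_modelData (a := a) (b := b) (S := S) hg hL i).prodMk h1
  have h3 := (measurable_solverOutput hs hε hδ).comp h2
  exact h3

theorem measurableSet_isGoodDraw (hf : Continuous f) (hh : IsClosedConvexProper h)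
    (hs : SolverAssumption f h M solver)
    (hg : ∀ j, Differentiable ℝ (g j)) (hL : UniformLipschitz g Lhat)
    (hε : 0 < εbar) (hδ : 0 < δbar) (τ i : ℕ) :
    MeasurableSet {p : (Vec n × Vec n) × Draw N a b S |
      IsGoodDraw f g h M lf solver εbar δbar τ i p.1 p.2} := by
  have hm := measurable_modelData (a := a) (b := b) (S := S) hg hL i
  have hdist : Measurable fun p : (Vec n × Vec n) × Draw N a b S => ‖p.1.2 - p.1.1‖ / (τ : ℝ) :=
    ((measurable_snd.sub measurable_fst).norm.comp measurable_fst).div_const _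
  have hx : Measurable fun p : (Vec n × Vec n) × Draw N a b S => p.1.2 :=
    measurable_snd.comp measurable_fst
  have h1 : Measurable fun p : (Vec n × Vec n) × Draw N a b S =>
      (lf : ℝ) * ‖valueEstimate g i p.1 p.2.1 - average g p.1.2‖ :=
    (hm.fst.sub ((continuous_average hg).measurable.comp hx)).norm.const_mul _
  have h2 : Measurable fun p : (Vec n × Vec n) × Draw N a b S =>
      (lf : ℝ) * ‖jacEstimate g i p.1 p.2.2.1 - averageJac g p.1.2‖ :=
    (hm.snd.fst.sub ((continuous_averageJac hL).measurable.comp hx)).norm.const_mul _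
  have h3 : MeasurableSet {p : (Vec n × Vec n) × Draw N a b S |
      IsAccurate f h M solver εbar δbar (modelData g i p.1 p.2) p.2.2.2} :=
    (hm.prodMk (measurable_snd.comp (measurable_snd.comp measurable_snd)))
      (measurableSet_isAccurate hf hh hs hε hδ)
  exact (measurableSet_le h1 ((hdist.pow_const 2).const_mul _)).inter
    ((measurableSet_le h2 (hdist.const_mul _)).inter h3)

end Measurability

/-! ### Failure probability of one iteration, and conditioning on the past. -/

section Probability

theorem prod_le_of_section_le {X Y : Type*} [MeasurableSpace X] [MeasurableSpace Y]
    {μ : Measure X} {ν : Measure Y} [IsProbabilityMeasure μ] [SFinite ν] {s : Set (X × Y)}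
    (hs : MeasurableSet s) {c : ENNReal} (h : ∀ x, ν (Prod.mk x ⁻¹' s) ≤ c) :
    μ.prod ν s ≤ c := by
  rw [Measure.prod_apply hs]
  refine (lintegral_mono h).trans ?_
  rw [lintegral_const, measure_univ, mul_one]

theorem prod_fst_preimage {X Y : Type*} [MeasurableSpace X] [MeasurableSpace Y]
    {μ : Measure X} {ν : Measure Y} [SFinite μ] [IsProbabilityMeasure ν] (s : Set X) :
    μ.prod ν {p | p.1 ∈ s} = μ s := by
  have : {p : X × Y | p.1 ∈ s} = s ×ˢ Set.univ := by ext; simp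
  rw [this, Measure.prod_prod, measure_univ, mul_one]

variable {m n N a b : ℕ} {f : Vec m → ℝ} {g : Fin N → Vec n → Vec m} {h : Vec n → EReal}
  {lf Lg Lhat : ℝ≥0} {M : ℝ} {S : Type*} [MeasurableSpace S] {solver : Solver n S}
  {εbar δbar : ℝ}

theorem law_not_isGoodDraw_le [NeZero N] (hM : 0 < M) (hf : Continuous f)
    (hh : IsClosedConvexProper h) (hs : SolverAssumption f h M solver)
    (hg : ∀ j, Differentiable ℝ (g j)) (hL : UniformLipschitz g Lhat)
    (hε : 0 < εbar) (hδ : 0 < δbar) {τ : ℕ} (hτ : 0 < τ)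
    {δ₁ : ℝ} (hδ₁ : 0 < δ₁) {Ca Cb : ℝ}
    (hl : 1 ≤ Real.log ((m + 1) / δ₁)) (hl' : 1 ≤ Real.log ((m + n) / δ₁))
    (hCa : 24 * 20 ^ 2 * ((lf * Lhat : ℝ) / M) ^ 2 + 1 ≤ Ca)
    (hCb : 24 * 10 ^ 2 * ((lf * Lhat : ℝ) / M) ^ 2 + 1 ≤ Cb)
    (ha : Ca * (τ : ℝ) ^ 4 * Real.log ((m + 1) / δ₁) ≤ a)
    (hb : Cb * (τ : ℝ) ^ 2 * Real.log ((m + n) / δ₁) ≤ b) (i : ℕ) (z : Vec n × Vec n) :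
    ((batchLaw N a).prod ((batchLaw N b).prod solver.law))
      {d | ¬ IsGoodDraw f g h M lf solver εbar δbar τ i z d} ≤
      ENNReal.ofReal (δ₁ + δ₁ + δbar) := by
  have := hs.isProbabilityMeasure
  set BA : Set (Fin a → Fin N) := {A | ¬ lf * ‖valueEstimate g i z A - average g z.2‖ ≤
      M / 20 * (‖z.2 - z.1‖ / τ) ^ 2} with hBA
  set BB : Set (Fin b → Fin N) := {B | ¬ lf * ‖jacEstimate g i z B - averageJac g z.2‖ ≤
      M / 10 * (‖z.2 - z.1‖ / τ)} with hBB
  set BS : Set (Draw N a b S) :=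
    {d | ¬ IsAccurate f h M solver εbar δbar (modelData g i z d) d.2.2} with hBS
  have hsub : {d : Draw N a b S | ¬ IsGoodDraw f g h M lf solver εbar δbar τ i z d} ⊆
      ({d | d.1 ∈ BA} ∪ {d | d.2 ∈ {e : (Fin b → Fin N) × S | e.1 ∈ BB}}) ∪ BS := by
    intro d hd
    simp only [IsGoodDraw, Set.mem_ofPred_eq, not_and_or] at hd
    rcases hd with hd | hd | hd
    · exact Or.inl (Or.inl hd)
    · exact Or.inl (Or.inr hd)
    · exact Or.inr hd
  have hBSm : MeasurableSet BS := by
    refine MeasurableSet.compl ?_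
    exact (((measurable_modelData (a := a) (b := b) (S := S) hg hL i).comp
      measurable_prodMk_left).prodMk (measurable_snd.comp measurable_snd))
      (measurableSet_isAccurate hf hh hs hε hδ)
  have h1 : ((batchLaw N a).prod ((batchLaw N b).prod solver.law)) {d | d.1 ∈ BA} ≤
      ENNReal.ofReal δ₁ := by
    rw [prod_fst_preimage]
    exact batchLaw_valueEstimate_bad_le hM hg hL hτ hδ₁ hl hCa ha i z
  have h2 : ((batchLaw N a).prod ((batchLaw N b).prod solver.law))
      {d | d.2 ∈ {e : (Fin b → Fin N) × S | e.1 ∈ BB}} ≤ ENNReal.ofReal δ₁ := by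
    have : {d : Draw N a b S | d.2 ∈ {e : (Fin b → Fin N) × S | e.1 ∈ BB}} =
        Set.univ ×ˢ {e | e.1 ∈ BB} := by ext; simp
    rw [this, Measure.prod_prod, measure_univ, one_mul, prod_fst_preimage]
    exact batchLaw_jacEstimate_bad_le hM hL hτ hδ₁ hl' hCb hb i z
  have h3 : ((batchLaw N a).prod ((batchLaw N b).prod solver.law)) BS ≤
      ENNReal.ofReal δbar := by
    -- The subproblem depends on both batches: these are frozen first, and the solver guarantee is
    -- then applied to the seed.
    refine prod_le_of_section_le hBSm fun A => ?_
    refine prod_le_of_section_le (measurable_prodMk_left hBSm) fun B => ?_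
    exact law_not_isAccurate_le hf hh hs hε hδ (valueEstimate g i z A, jacEstimate g i z B, z.2)
  rw [ENNReal.ofReal_add (by positivity) hδ.le, ENNReal.ofReal_add hδ₁.le hδ₁.le]
  exact (measure_mono hsub).trans ((measure_union_le _ _).trans
    (add_le_add ((measure_union_le _ _).trans (add_le_add h1 h2)) h3))

variable {Ω : Type*}

/-- The σ-algebra generated by the random inputs before the inner iteration `(k, i)`. -/
@[reducible]
def pastDraws (K τ : ℕ) (draw : ℕ → ℕ → Ω → Draw N a b S) (k i : ℕ) : MeasurableSpace Ω :=
  ⨆ p ∈ {p : Fin K × Fin τ | p.1 < k ∨ p.1 = k ∧ p.2 < i},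
    MeasurableSpace.comap (draw p.1 p.2) inferInstance

theorem pastDraws_mono {K τ : ℕ} (draw : ℕ → ℕ → Ω → Draw N a b S) {k i k' i' : ℕ}
    (hki : k < k' ∨ k = k' ∧ i ≤ i') : pastDraws K τ draw k i ≤ pastDraws K τ draw k' i' := by
  refine biSup_mono fun p hp => ?_
  rw [Set.mem_ofPred_eq] at hp ⊢
  omega

theorem measurable_draw_pastDraws {K τ : ℕ} (draw : ℕ → ℕ → Ω → Draw N a b S) {k i : ℕ}
    (hk : k < K) (hi : i < τ) : Measurable[pastDraws K τ draw k (i + 1)] (draw k i) := by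
  rw [measurable_iff_comap_le]
  exact le_iSup₂_of_le (f := fun (p : Fin K × Fin τ) _ =>
    MeasurableSpace.comap (draw p.1 p.2) inferInstance) (⟨k, hk⟩, ⟨i, hi⟩) (by simp) le_rfl

/-- The iterates are adapted. Induction runs along an epoch and then over epochs; the last iterate
of an epoch uses only draws that precede the next one. -/
theorem measurable_iterate (hs : SolverAssumption f h M solver)
    (hg : ∀ j, Differentiable ℝ (g j)) (hL : UniformLipschitz g Lhat)
    (hε : 0 < εbar) (hδ : 0 < δbar) {K τ : ℕ} (draw : ℕ → ℕ → Ω → Draw N a b S) (x₀ : Vec n)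
    {k : ℕ} (hk : k < K) : ∀ {i : ℕ}, i ≤ τ → Measurable[pastDraws K τ draw k i] fun ω =>
      iterate f g h M solver εbar δbar (fun _ => τ) (fun k i => draw k i ω) x₀ k i := by
  have inner : ∀ k < K, (Measurable[pastDraws K τ draw k 0] fun ω =>
        iterate f g h M solver εbar δbar (fun _ => τ) (fun k i => draw k i ω) x₀ k 0) →
      ∀ i ≤ τ, Measurable[pastDraws K τ draw k i] fun ω =>
        iterate f g h M solver εbar δbar (fun _ => τ) (fun k i => draw k i ω) x₀ k i := by
    intro k hk h0 i
    induction i with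
    | zero => intro _; exact h0
    | succ i ih =>
      intro hi
      simp only [iterate_succ]
      have h1 := (ih (by omega)).mono (pastDraws_mono draw (k' := k) (i' := i + 1)
        (Or.inr ⟨rfl, by omega⟩)) le_rfl
      have h2 := h0.mono (pastDraws_mono draw (k' := k) (i' := i + 1)
        (Or.inr ⟨rfl, by omega⟩)) le_rfl
      have h3 := (h2.prodMk h1).prodMk
        (measurable_draw_pastDraws (K := K) (τ := τ) draw hk (by omega : i < τ))
      have h4 := (measurable_nextIterate (a := a) (b := b) hs hg hL hε hδ i).comp h3
      exact h4
  have outer : ∀ k < K, Measurable[pastDraws K τ draw k 0] fun ω =>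
        iterate f g h M solver εbar δbar (fun _ => τ) (fun k i => draw k i ω) x₀ k 0 := by
    intro k
    induction k with
    | zero =>
      intro _
      simp only [iterate_zero_zero]
      exact measurable_const
    | succ k ih =>
      intro hk
      simp only [iterate_succ_zero]
      exact (inner k (by omega) (ih (by omega)) τ le_rfl).mono
        (pastDraws_mono draw (Or.inl (Nat.lt_succ_self k))) le_rfl
  exact fun {i} hi => inner k hk (outer k hk) i hi

variable [MeasurableSpace Ω] {P : Measure Ω}

theorem pastDraws_le {K τ : ℕ} {draw : ℕ → ℕ → Ω → Draw N a b S}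
    (hd : IsDraws (n := n) P solver K τ draw) (k i : ℕ) :
    pastDraws K τ draw k i ≤ ‹MeasurableSpace Ω› :=
  iSup₂_le fun p _ => (hd.measurable p.1 p.1.2 p.2 p.2.2).comap_le

theorem indep_pastDraws {K τ : ℕ} {draw : ℕ → ℕ → Ω → Draw N a b S}
    (hd : IsDraws (n := n) P solver K τ draw) {k i : ℕ} (hk : k < K) (hi : i < τ) :
    Indep (pastDraws K τ draw k i) (MeasurableSpace.comap (draw k i) inferInstance) P := by
  have h1 := indep_iSup_of_disjoint (m := fun p : Fin K × Fin τ =>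
      MeasurableSpace.comap (draw p.1 p.2) inferInstance)
    (fun p => (hd.measurable p.1 p.1.2 p.2 p.2.2).comap_le)
    ((iIndepFun_iff_iIndep _ _ _).1 hd.indep)
    (S := {p : Fin K × Fin τ | p.1 < k ∨ p.1 = k ∧ p.2 < i})
    (T := {((⟨k, hk⟩, ⟨i, hi⟩) : Fin K × Fin τ)}) (by
      rw [Set.disjoint_singleton_right, Set.mem_ofPred_eq]
      simp)
  simpa [pastDraws] using h1

/-- Conditioning on the past: an event about a state determined by the past and about the current
random input has small probability if it does for every value of the state. -/
theorem prob_state_draw_le [IsProbabilityMeasure P] {K τ : ℕ}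
    {draw : ℕ → ℕ → Ω → Draw N a b S} (hs : IsProbabilityMeasure solver.law) [NeZero N]
    (hd : IsDraws (n := n) P solver K τ draw) {k i : ℕ} (hk : k < K) (hi : i < τ)
    {Z : Type*} [MeasurableSpace Z] {st : Ω → Z} (hst : Measurable[pastDraws K τ draw k i] st)
    {B : Set (Z × Draw N a b S)} (hB : MeasurableSet B) {c : ENNReal}
    (hc : ∀ z, ((batchLaw N a).prod ((batchLaw N b).prod solver.law)) (Prod.mk z ⁻¹' B) ≤ c) :
    P {ω | (st ω, draw k i ω) ∈ B} ≤ c := by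
  have hst' : Measurable st := hst.mono (pastDraws_le hd k i) le_rfl
  have hdm := hd.measurable k hk i hi
  have hind : IndepFun st (draw k i) P := by
    rw [IndepFun_iff_Indep]
    exact indep_of_indep_of_le_left (indep_pastDraws hd hk hi) hst.comap_le
  have hmap := (indepFun_iff_map_prod_eq_prod_map_map hst'.aemeasurable hdm.aemeasurable).1 hind
  have := Measure.isProbabilityMeasure_map (μ := P) hst'.aemeasurable
  rw [hd.law k hk i hi] at hmap
  calc P {ω | (st ω, draw k i ω) ∈ B} = P.map (fun ω => (st ω, draw k i ω)) B := by
        rw [Measure.map_apply (hst'.prodMk hdm) hB]; rfl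
    _ ≤ c := by
        rw [hmap]
        exact prod_le_of_section_le hB hc

end Probability

/-! ### Descent on good runs, and the union bound. -/

section Convergence

variable {m n N a b : ℕ} {f : Vec m → ℝ} {g : Fin N → Vec n → Vec m} {h : Vec n → EReal}
  {lf Lg Lhat : ℝ≥0} {M : ℝ} {S : Type*} [MeasurableSpace S] {solver : Solver n S}
  {εbar δbar : ℝ}

/-- Decrease of the objective along a step with precise estimates and an accurate solver. -/
theorem IsGoodDraw.descent (hM : 0 < M) (hMl : 5 * (lf : ℝ) * (Lg : ℝ) < M)
    (hA : StandingAssumptions f g h lf Lg) (hbdd : ⊥ < ⨅ x, objective f g h x) {τ i : ℕ}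
    {x₀ x y : Vec n} (hx : h x ≠ ⊤) {d : Draw N a b S}
    (hd : IsGoodDraw f g h M lf solver εbar δbar τ i (x₀, x) d)
    (hy : y = nextIterate f g h M solver εbar δbar i (x₀, x) d) :
    h y ≠ ⊤ ∧ f (average g y) + (h y).toReal ≤ f (average g x) + (h x).toReal
      - 9 / 20 * M * ‖x - proxLinearStep f g h M x‖ ^ 2 - M / 4 * ‖y - x‖ ^ 2
      + M / 5 * (‖x - x₀‖ / τ) ^ 2 + εbar := by
  obtain ⟨h1, h2, h3⟩ := hd
  have hJ : averageJac g x = fderiv ℝ (average g) x := (fderiv_average hA.g_differentiable x).symm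
  simp only at h1 h2
  rw [hJ] at h2
  obtain ⟨hyt, h4⟩ := objective_descent hM hA hbdd hx (le_refl ‖valueEstimate g i (x₀, x) d.1 -
    average g x‖) (le_refl ‖jacEstimate g i (x₀, x) d.2.1 - fderiv ℝ (average g) x‖) (y := y)
    (εbar := εbar) (by rw [hy]; exact h3)
  refine ⟨hyt, h4.trans ?_⟩
  set P := ‖x - proxLinearStep f g h M x‖
  set D := ‖y - x‖
  set ρ := ‖x - x₀‖ / (τ : ℝ)
  have h5 : lf * ‖jacEstimate g i (x₀, x) d.2.1 - fderiv ℝ (average g) x‖ * (D + P) ≤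
      M / 10 * ρ * (D + P) := mul_le_mul_of_nonneg_right h2 (by positivity)
  -- Scaled by `1/20`, this spends `M/20` of each of the `P²` and `D²` gains; with `lf Lg ≤ M/5`
  -- there remain `9M/20` and `M/4`. The two errors contribute `M/10` each to the coefficient of
  -- `ρ²`.
  have h6 : M * (2 * (ρ * (D + P))) ≤ M * (2 * ρ ^ 2 + D ^ 2 + P ^ 2) :=
    mul_le_mul_of_nonneg_left (by nlinarith [sq_nonneg (ρ - D), sq_nonneg (ρ - P)]) hM.le
  have h7 : (lf * Lg : ℝ) * D ^ 2 ≤ M / 5 * D ^ 2 :=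
    mul_le_mul_of_nonneg_right (by linarith) (sq_nonneg D)
  linarith

/-- A run all of whose steps are good has small average squared generalized gradient. -/
theorem average_genGrad_le (hM : 0 < M) (hMl : 5 * (lf : ℝ) * (Lg : ℝ) < M)
    (hA : StandingAssumptions f g h lf Lg) (hbdd : ⊥ < ⨅ x, objective f g h x) {D : ℝ}
    (hD : 0 ≤ D) {x : ℕ → ℕ → Vec n}
    (hx₀ : objective f g h (x 0 0) ≤ (⨅ x, objective f g h x) + (D : EReal)) {K τ : ℕ}
    {d : ℕ → ℕ → Draw N a b S} (hnext : ∀ k, x (k + 1) 0 = x k τ)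
    (hstep : ∀ k i, x k (i + 1) = nextIterate f g h M solver εbar δbar i (x k 0, x k i) (d k i))
    (hgood : ∀ k < K, ∀ i < τ,
      IsGoodDraw f g h M lf solver εbar δbar τ i (x k 0, x k i) (d k i))
    {ε : ℝ} (hε : 0 < ε) (hKτ : (4 * M * D + 1) * ε⁻¹ ≤ (K : ℝ) * τ)
    (hεbar : εbar = ε / (5 * 30 * M)) :
    1 / ((K : ℝ) * τ) * ∑ k ∈ Finset.range K, ∑ i ∈ Finset.range τ,
      ‖genGrad f g h M (x k i)‖ ^ 2 ≤ ε := by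
  have hh := hA.h_closedConvexProper
  obtain ⟨φ, hφ, hlow⟩ := exists_iInf_objective_eq hh hbdd
  have h00 : h (x 0 0) ≠ ⊤ := by
    intro hc
    rw [objective, hc, EReal.coe_add_top, hφ, ← EReal.coe_add] at hx₀
    exact absurd hx₀ (not_le.2 (EReal.coe_lt_top _))
  set F : Vec n → ℝ := fun x => f (average g x) + (h x).toReal with hF
  have hF0 : F (x 0 0) ≤ φ + D := by
    rw [objective, ← hh.coe_toReal h00, hφ, ← EReal.coe_add, ← EReal.coe_add,
      EReal.coe_le_coe_iff] at hx₀
    exact hx₀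
  have hepoch : ∀ k < K, h (x k 0) ≠ ⊤ → h (x k τ) ≠ ⊤ ∧ F (x k τ) ≤ F (x k 0) -
      9 / 20 * M * ∑ i ∈ Finset.range τ, ‖x k i - proxLinearStep f g h M (x k i)‖ ^ 2 +
        τ * εbar := by
    intro k hk h0
    have hfin : ∀ i ≤ τ, h (x k i) ≠ ⊤ := by
      intro i
      induction i with
      | zero => intro _; exact h0
      | succ i ih =>
        intro hi
        exact ((hgood k hk i hi).descent hM hMl hA hbdd (ih (by omega)) (hstep k i)).1
    refine ⟨hfin τ le_rfl, ?_⟩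
    refine epoch_decrease (φ := fun i => F (x k i))
      (P := fun i => ‖x k i - proxLinearStep f g h M (x k i)‖)
      (d := fun i => ‖x k (i + 1) - x k i‖) (ρ := fun i => ‖x k i - x k 0‖) hM
      (fun i _ => ⟨norm_nonneg _, ?_⟩) (fun i => norm_nonneg _) fun i hi => ?_
    · have := dist_le_range_sum_dist (x k) i
      simp only [dist_eq_norm'] at this
      exact this
    · exact ((hgood k hk i hi).descent hM hMl hA hbdd (hfin i hi.le) (hstep k i)).2
  have htotal : ∀ k ≤ K, h (x k 0) ≠ ⊤ ∧ F (x k 0) ≤ F (x 0 0) - 9 / 20 * M *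
      ∑ k ∈ Finset.range k, ∑ i ∈ Finset.range τ,
        ‖x k i - proxLinearStep f g h M (x k i)‖ ^ 2 + k * (τ * εbar) := by
    intro k
    induction k with
    | zero => intro _; exact ⟨h00, by simp⟩
    | succ k ih =>
      intro hk
      obtain ⟨i1, i2⟩ := ih (by omega)
      obtain ⟨j1, j2⟩ := hepoch k (by omega) i1
      rw [hnext, Finset.sum_range_succ]
      refine ⟨j1, ?_⟩
      push_cast
      linarith
  obtain ⟨t1, t2⟩ := htotal K le_rfl
  have t3 : φ ≤ F (x K 0) := hlow _ t1
  have hgrad : ∀ k i, ‖genGrad f g h M (x k i)‖ ^ 2 =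
      M ^ 2 * ‖x k i - proxLinearStep f g h M (x k i)‖ ^ 2 := fun k i => by
    rw [genGrad, norm_smul, mul_pow, Real.norm_eq_abs, sq_abs]
  simp only [hgrad, ← Finset.mul_sum]
  set Q := ∑ k ∈ Finset.range K, ∑ i ∈ Finset.range τ,
        ‖x k i - proxLinearStep f g h M (x k i)‖ ^ 2
  have hT : 0 < (K : ℝ) * τ := lt_of_lt_of_le (by positivity) hKτ
  set T := (K : ℝ) * τ with hT_def
  have h1 : 9 / 20 * M * Q ≤ D + T * εbar := by
    rw [hT_def, mul_assoc (K : ℝ)]; linarith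
  have h2 : 4 * M * D + 1 ≤ T * ε := by
    rwa [← div_eq_mul_inv, div_le_iff₀ hε] at hKτ
  have h3 : M * εbar = ε / 150 := by rw [hεbar]; field_simp; norm_num
  have h4 := mul_le_mul_of_nonneg_left h1 hM.le
  rw [one_div, inv_mul_le_iff₀ hT]
  have h5 : M * (T * εbar) = T * ε / 150 := by rw [mul_left_comm, h3]; ring
  -- `M² Q ≤ (20/9)(M D + T ε / 150)` and `4 M D ≤ T ε`, which leaves less than `T ε`.
  nlinarith

theorem prob_average_genGrad_le [NeZero N] (hm : 0 < m) (hn : 0 < n) (hM : 0 < M)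
    (hMl : 5 * (lf : ℝ) * (Lg : ℝ) < M)
    (hA : StandingAssumptions f g h lf Lg) (hL : UniformLipschitz g Lhat)
    (hbdd : ⊥ < ⨅ x, objective f g h x) {D : ℝ} (hD : 0 ≤ D) {x₀ : Vec n}
    (hx₀ : objective f g h x₀ ≤ (⨅ x, objective f g h x) + (D : EReal))
    (hs : SolverAssumption f h M solver) {Δ : ℝ} (hΔ : 0 < Δ) (hΔ1 : Δ < 1) {τ : ℕ} (hτ : 0 < τ)
    {ε : ℝ} (hε : 0 < ε) {K : ℕ} (hK : (4 * M * D + 1) * ε⁻¹ ≤ (K : ℝ) * τ)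
    (hK1 : 1 ≤ (K : ℝ) * τ) {Ca Cb : ℝ}
    (hCa : 24 * 20 ^ 2 * ((lf * Lhat : ℝ) / M) ^ 2 + 1 ≤ Ca)
    (hCb : 24 * 10 ^ 2 * ((lf * Lhat : ℝ) / M) ^ 2 + 1 ≤ Cb)
    (ha : Ca * (τ : ℝ) ^ 4 * Real.log (4 * (m + 1) * K * τ / Δ) ≤ a)
    (hb : Cb * (τ : ℝ) ^ 2 * Real.log (4 * (m + n) * K * τ / Δ) ≤ b)
    (hδbar : δbar = Δ / (2 * K * τ)) (hεbar : εbar = ε / (5 * 30 * M))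
    {Ω : Type*} [MeasurableSpace Ω] {P : Measure Ω} [IsProbabilityMeasure P]
    {draw : ℕ → ℕ → Ω → Draw N a b S} (hd : IsDraws P solver K τ draw) :
    ENNReal.ofReal (1 - Δ) ≤ P {ω |
      1 / ((K : ℝ) * τ) * ∑ k ∈ Finset.range K, ∑ i ∈ Finset.range τ,
        ‖genGrad f g h M (iterate f g h M solver εbar δbar (fun _ => τ)
          (fun k i => draw k i ω) x₀ k i)‖ ^ 2 ≤ ε} := by
  have hsp := hs.isProbabilityMeasure
  have hKτ : 0 < (K : ℝ) * τ := lt_of_lt_of_le one_pos hK1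
  have hδ0 : 0 < δbar := by rw [hδbar, mul_assoc]; positivity
  have hε0 : 0 < εbar := by rw [hεbar]; positivity
  have hf := hA.f_lipschitz.continuous
  have hh := hA.h_closedConvexProper
  have hg := hA.g_differentiable
  -- The failure budget `Δ / (K τ)` of an iteration: a quarter for each batch and half for the
  -- solver. With this choice the Hoeffding logarithms are those in the batch sizes.
  set δ₁ : ℝ := Δ / (4 * (K * τ)) with hδ₁
  have hδ₁0 : 0 < δ₁ := by positivity
  have hquot : ∀ c : ℝ, c / δ₁ = 4 * c * K * τ / Δ := fun c => by
    rw [hδ₁]; field_simp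
  have hm1 : (2 : ℝ) ≤ m + 1 := by
    have : (1 : ℝ) ≤ m := Nat.one_le_cast.2 hm
    linarith
  have hmn : (2 : ℝ) ≤ m + n := by
    have : (1 : ℝ) ≤ m := Nat.one_le_cast.2 hm
    have : (1 : ℝ) ≤ n := Nat.one_le_cast.2 hn
    linarith
  have hlog : ∀ c : ℝ, 2 ≤ c → 1 ≤ Real.log (c / δ₁) := fun c hc => by
    rw [hquot, mul_assoc (4 * c)]
    exact one_le_log (eight_le_div hc hK1 hΔ hΔ1)
  set X : ℕ → ℕ → Ω → Vec n := fun k i ω => iterate f g h M solver εbar δbar (fun _ => τ)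
    (fun k i => draw k i ω) x₀ k i with hX
  set bad : ℕ → ℕ → Set Ω := fun k i => {ω | ¬ IsGoodDraw f g h M lf solver εbar δbar τ i
    (X k 0 ω, X k i ω) (draw k i ω)} with hbad
  have hbad_le : ∀ k < K, ∀ i < τ, P (bad k i) ≤ ENNReal.ofReal (Δ / (K * τ)) := by
    intro k hk i hi
    have hst : Measurable[pastDraws K τ draw k i] fun ω => (X k 0 ω, X k i ω) := by
      have h1 := (measurable_iterate hs hg hL hε0 hδ0 draw x₀ hk (Nat.zero_le τ)).mono
        (pastDraws_mono draw (k' := k) (i' := i) (Or.inr ⟨rfl, Nat.zero_le i⟩)) le_rfl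
      have h2 := measurable_iterate hs hg hL hε0 hδ0 draw x₀ hk hi.le
      exact h1.prodMk h2
    have hB := (measurableSet_isGoodDraw (a := a) (b := b) (lf := lf) hf hh hs hg hL hε0 hδ0
      τ i).compl
    refine (prob_state_draw_le hsp hd hk hi hst hB
      (c := ENNReal.ofReal (δ₁ + δ₁ + δbar)) fun z => ?_).trans (le_of_eq ?_)
    · exact law_not_isGoodDraw_le hM hf hh hs hg hL hε0 hδ0 hτ hδ₁0 (hlog _ hm1) (hlog _ hmn)
        hCa hCb (by rwa [hquot]) (by rwa [hquot]) i z
    · congr 1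
      rw [hδ₁, hδbar]
      field_simp
      norm_num
  set target : Set Ω := {ω | 1 / ((K : ℝ) * τ) * ∑ k ∈ Finset.range K, ∑ i ∈ Finset.range τ,
        ‖genGrad f g h M (X k i ω)‖ ^ 2 ≤ ε} with htarget
  -- Covering the whole space, instead of taking complements, requires no measurability of the
  -- target event.
  have hcover : (Set.univ : Set Ω) ⊆
      (⋃ k ∈ Finset.range K, ⋃ i ∈ Finset.range τ, bad k i) ∪ target := by
    intro ω _
    by_cases hω : ω ∈ ⋃ k ∈ Finset.range K, ⋃ i ∈ Finset.range τ, bad k i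
    · exact Or.inl hω
    · refine Or.inr ?_
      simp only [Set.mem_iUnion, Finset.mem_range, not_exists] at hω
      refine average_genGrad_le hM hMl hA hbdd hD (x := fun k i => X k i ω) hx₀
        (d := fun k i => draw k i ω) (fun k => rfl) (fun k i => iterate_succ ..)
        (fun k hk i hi => not_not.1 (hω k hk i hi)) hε hK hεbar
  have hsum : P (⋃ k ∈ Finset.range K, ⋃ i ∈ Finset.range τ, bad k i) ≤ ENNReal.ofReal Δ := by
    have h1 : ∀ k ∈ Finset.range K, P (⋃ i ∈ Finset.range τ, bad k i) ≤
        τ * ENNReal.ofReal (Δ / (K * τ)) := fun k hk => by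
      refine (measure_biUnion_finset_le _ _).trans ((Finset.sum_le_sum fun i hi =>
        hbad_le k (Finset.mem_range.1 hk) i (Finset.mem_range.1 hi)).trans (le_of_eq ?_))
      simp
    refine (measure_biUnion_finset_le _ _).trans ((Finset.sum_le_sum h1).trans (le_of_eq ?_))
    rw [Finset.sum_const, Finset.card_range, nsmul_eq_mul, ← mul_assoc,
      ← ENNReal.ofReal_natCast K, ← ENNReal.ofReal_natCast τ,
      ← ENNReal.ofReal_mul (Nat.cast_nonneg K), ← ENNReal.ofReal_mul hKτ.le,
      mul_div_cancel₀ _ hKτ.ne']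
  have hone : 1 ≤ ENNReal.ofReal Δ + P target := by
    rw [← measure_univ (μ := P)]
    exact (measure_mono hcover).trans ((measure_union_le _ _).trans (add_le_add hsum le_rfl))
  rw [ENNReal.ofReal_sub _ hΔ.le, ENNReal.ofReal_one]
  exact tsub_le_iff_left.2 hone

end Convergence

end ProxLinear

/-! ### Choice of the constants and assembly. -/

theorem corollary8 (lf Lg Lhat : ℝ≥0) (M D : ℝ) (hM : 0 < M)
    (hMl : 5 * (lf : ℝ) * (Lg : ℝ) < M) (hD : 0 ≤ D) :
    ∃ CS Ca Cb c C : ℝ, 0 < CS ∧ 0 < Ca ∧ 0 < Cb ∧ 0 < c ∧ 0 < C ∧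
    ∀ (m n N : ℕ), 0 < m → 0 < n → 0 < N →
    ∀ (f : Vec m → ℝ) (g : Fin N → Vec n → Vec m) (h : Vec n → EReal) (x₀ : Vec n),
    StandingAssumptions f g h lf Lg → UniformLipschitz g Lhat →
    ⊥ < (⨅ x, objective f g h x) →
    objective f g h x₀ ≤ (⨅ x, objective f g h x) + (D : EReal) →
    ∀ (S : Type*) [MeasurableSpace S] (solver : Solver n S), SolverAssumption f h M solver →
    ∀ (Δ : ℝ), 0 < Δ → Δ < 1 → ∀ (τ : ℕ), 0 < τ → ∀ (ε : ℝ), 0 < ε →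
    ∀ (K a b : ℕ), K = ⌈CS * ε⁻¹ / τ⌉₊ →
    a = ⌈Ca * (τ : ℝ) ^ 4 * Real.log (4 * (m + 1) * K * τ / Δ)⌉₊ →
    b = ⌈Cb * (τ : ℝ) ^ 2 * Real.log (4 * (m + n) * K * τ / Δ)⌉₊ →
    ∀ (δbar εbar : ℝ), δbar = Δ / (2 * K * τ) → εbar = ε / (5 * 30 * M) →
    ∀ (Ω : Type*) [MeasurableSpace Ω] (P : Measure Ω) [IsProbabilityMeasure P]
      (draw : ℕ → ℕ → Ω → Draw N a b S), IsDraws P solver K τ draw →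
    -- the prox-linear step, hence the generalized gradient, is well defined
    (∀ x, ∃! y, IsProxLinearStep f g h M x y) ∧
    -- (i) stationarity with high probability
    ENNReal.ofReal (1 - Δ) ≤ P {ω |
      1 / ((K : ℝ) * τ) * ∑ k ∈ Finset.range K, ∑ i ∈ Finset.range τ,
        ‖genGrad f g h M (iterate f g h M solver εbar δbar (fun _ => τ)
          (fun k i => draw k i ω) x₀ k i)‖ ^ 2 ≤ ε} ∧
    -- (ii) numbers of oracle calls, on every run
    ∀ ω, ∀ run : Counted (Vec n),
      run = method f g h M solver εbar δbar (fun _ => τ) (fun k i => draw k i ω) x₀ K →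
      (c * evalRate N τ ε ≤ run.evals ∧
        run.evals ≤ C * evalRate N τ ε * Real.log (4 * (m + 1) * (τ + ε⁻¹) / Δ)) ∧
      (c * jacRate N τ ε ≤ run.jacs ∧
        run.jacs ≤ C * jacRate N τ ε * Real.log (4 * (m + n) * (τ + ε⁻¹) / Δ)) ∧
      -- for small `ε` the logarithmic factors depend on `ε` only
      (ε ≤ 1 / 2 → ε ≤ 1 / τ → ε ≤ Δ / (m + n) →
        run.evals ≤ C * evalRate N τ ε * Real.log ε⁻¹ ∧
        run.jacs ≤ C * jacRate N τ ε * Real.log ε⁻¹) := by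
  set Ca : ℝ := 24 * 20 ^ 2 * ((lf * Lhat : ℝ) / M) ^ 2 + 1 with hCa
  set Cb : ℝ := 24 * 10 ^ 2 * ((lf * Lhat : ℝ) / M) ^ 2 + 1 with hCb
  -- The summand 1 keeps the constant positive when `D = 0`.
  set CS : ℝ := 4 * M * D + 1 with hCS
  have hCa0 : 0 < Ca := by positivity
  have hCb0 : 0 < Cb := by positivity
  have hCS0 : 0 < CS := by positivity
  have hlog0 : 0 ≤ Real.log (CS + 1) := Real.log_nonneg (by linarith)
  set c₁ : ℝ := min 1 CS / 2 * (min 1 Ca / 2) with hc₁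
  set c₂ : ℝ := min 1 CS / 2 * (min 1 Cb / 2) with hc₂
  set C₁ : ℝ := (CS + 1) * (Ca + 1) * (Real.log (CS + 1) + 1) with hC₁
  set C₂ : ℝ := (CS + 1) * (Cb + 1) * (Real.log (CS + 1) + 1) with hC₂
  have hC₁0 : 0 < C₁ := by positivity
  have hC₂0 : 0 < C₂ := by positivity
  -- One pair of constants serves both oracles; the 5 comes from `log_le_of_small`.
  refine ⟨CS, Ca, Cb, min c₁ c₂, 5 * (C₁ + C₂), hCS0, hCa0, hCb0, ?_, by positivity, ?_⟩
  · have h1 : 0 < min 1 CS := lt_min one_pos hCS0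
    have h2 : 0 < min 1 Ca := lt_min one_pos hCa0
    have h3 : 0 < min 1 Cb := lt_min one_pos hCb0
    exact lt_min (by positivity) (by positivity)
  intro m n N hm hn hN f g h x₀ hA hL hbdd hx₀ S _ solver hs Δ hΔ hΔ1 τ hτ ε hε K a b hK ha hb
    δbar εbar hδbar hεbar Ω _ P _ draw hd
  have : NeZero N := ⟨hN.ne'⟩
  have hτ' : (0 : ℝ) < τ := Nat.cast_pos.2 hτ
  have hK1 : 1 ≤ (K : ℝ) * τ := one_le_ceil_mul hCS0 hε hτ hK
  have hKCS : CS * ε⁻¹ ≤ (K : ℝ) * τ := by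
    rw [← div_le_iff₀ hτ', hK]
    exact Nat.le_ceil _
  have hm1 : (1 : ℝ) ≤ m := Nat.one_le_cast.2 hm
  have hn1 : (1 : ℝ) ≤ n := Nat.one_le_cast.2 hn
  refine ⟨existsUnique_isProxLinearStep hM hA hbdd, ?_, ?_⟩
  · exact prob_average_genGrad_le hm hn hM hMl hA hL hbdd hD hx₀ hs hΔ hΔ1 hτ hε hKCS hK1
      hCa.ge hCb.ge (by rw [ha]; exact Nat.le_ceil _) (by rw [hb]; exact Nat.le_ceil _)
      hδbar hεbar hd
  rintro ω run rfl
  obtain ⟨he, hj⟩ := method_counts f g h M solver εbar δbar (fun k i => draw k i ω) x₀ hτ K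
  rw [he, hj, evalRate_eq N hτ, jacRate_eq N hτ]
  have hq : 0 < 1 + ε⁻¹ * (τ : ℝ)⁻¹ := by positivity
  set R₁ : ℝ := (N + (τ : ℝ) ^ (4 + 1)) * (1 + ε⁻¹ * (τ : ℝ)⁻¹) with hR₁
  set R₂ : ℝ := (N + (τ : ℝ) ^ (2 + 1)) * (1 + ε⁻¹ * (τ : ℝ)⁻¹) with hR₂
  have hR₁0 : 0 < R₁ := by positivity
  have hR₂0 : 0 < R₂ := by positivity
  have lo₁ := le_count hCS0 hCa0 hN hτ hε hΔ hΔ1 (d := m + 1) (by linarith) hK ha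
  have lo₂ := le_count hCS0 hCb0 hN hτ hε hΔ hΔ1 (d := m + n) (by linarith) hK hb
  have up₁ := count_le hCS0 hCa0 hN hτ hε hΔ hΔ1 (d := m + 1) (by linarith) hK ha
  have up₂ := count_le hCS0 hCb0 hN hτ hε hΔ hΔ1 (d := m + n) (by linarith) hK hb
  rw [← hC₁, ← hR₁] at up₁
  rw [← hC₂, ← hR₂] at up₂
  have hε' : 0 < ε⁻¹ := inv_pos.2 hε
  have hτ1 : (1 : ℝ) ≤ τ := Nat.one_le_cast.2 hτ
  have hl₁ : 1 ≤ Real.log (4 * (m + 1) * (τ + ε⁻¹) / Δ) :=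
    one_le_log (eight_le_div (by linarith) (by linarith) hΔ hΔ1)
  have hl₂ : 1 ≤ Real.log (4 * (m + n) * (τ + ε⁻¹) / Δ) :=
    one_le_log (eight_le_div (by linarith) (by linarith) hΔ hΔ1)
  refine ⟨⟨?_, ?_⟩, ⟨?_, ?_⟩, fun h1 h2 h3 => ?_⟩
  · exact (mul_le_mul_of_nonneg_right (min_le_left _ _) hR₁0.le).trans lo₁
  · refine up₁.trans (mul_le_mul_of_nonneg_right (mul_le_mul_of_nonneg_right ?_ hR₁0.le)
      (zero_le_one.trans hl₁))
    linarith
  · exact (mul_le_mul_of_nonneg_right (min_le_right _ _) hR₂0.le).trans lo₂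
  · refine up₂.trans (mul_le_mul_of_nonneg_right (mul_le_mul_of_nonneg_right ?_ hR₂0.le)
      (zero_le_one.trans hl₂))
    linarith
  have h3' : ε ≤ Δ / (m + 1) :=
    h3.trans (div_le_div_of_nonneg_left hΔ.le (by positivity) (by linarith))
  have s₁ := log_le_of_small hτ hε hΔ (d := m + 1) (by linarith) h1 h2 h3'
  have s₂ := log_le_of_small hτ hε hΔ (d := m + n) (by linarith) h1 h2 h3
  have hlε : 0 ≤ Real.log ε⁻¹ := by linarith
  constructor
  · refine up₁.trans ((mul_le_mul_of_nonneg_left s₁ (by positivity)).trans ?_)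
    have := mul_nonneg (mul_nonneg hC₂0.le hR₁0.le) hlε
    linarith
  · refine up₂.trans ((mul_le_mul_of_nonneg_left s₂ (by positivity)).trans ?_)
    have := mul_nonneg (mul_nonneg hC₁0.le hR₂0.le) hlε
    linarith
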